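/- Let $d\ge 2$ and let $\Omega\subset\mathbb R^d$ be a bounded domain (a bounded, open, connected, non-empty set), with Lebesgue measure $|\Omega|$. Let $-\Delta^D_\Omega$ be the Dirichlet Laplacian on $\Omega$, i.e. the self-adjoint operator on $L^2(\Omega)$ associated with the quadratic form $\int_\Omega|\nabla u|^2$ on $H^1_0(\Omega)$. Let $\lambda_1\le\lambda_2\le\cdots$ be its eigenvalues, repeated according to multiplicity, and let $u_1,u_2,\dots$ be corresponding real-valued eigenfunctions, orthonormal in $L^2(\Omega)$. Write $\|\cdot\|_2$ and $\|\cdot\|_\infty$ for the norms of $L^2(\Omega)$ and $L^\infty(\Omega)$, $x_+=\max(x,0)$, $\omega_d=\pi^{d/2}/\Gamma(1+d/2)$ (the volume of the unit ball of $\mathbb R^d$) and $C_d=4\pi^2\omega_d^{-2/d}$. Then for every real-valued $\phi\in H^1_0(\Omega)\cap L^\infty(\Omega)$ with $\phi\neq 0$ the following hold. 1. For every $z>0$ the series below converges and $$\sum_{j}(z-\lambda_j)_+\,\|\phi u_j\|_2^2\;\ge\;\frac{2}{d+2}\,(2\pi)^{-d}\,\omega_d\,\|\phi\|_2^2\left(z-\frac{\|\nabla\phi\|_2^2}{\|\phi\|_2^2}\right)_+^{\frac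 d2+1}.$$ 2. For every positive integer $k$, $$\frac1k\sum_{j=1}^k\lambda_j\;\le\;\frac{\|\nabla\phi\|_2^2}{\|\phi\|_2^2}+\frac{d}{d+2}\,C_d\left(\frac{k}{|\Omega|}\right)^{\frac2d}\rho(\phi)^{-\frac2d},\qquad\text{where}\quad \rho(\phi):=\frac{\|\phi\|_2^2}{|\Omega|\,\|\phi\|_\infty^2}.$$ 3. $\rho(\phi)<1$. -/

import Mathlib

open MeasureTheory Filter Topology
open scoped ContDiff ENNReal

noncomputable section

namespace DirichletRiesz

variable {d : ℕ}

/-- `Ω` is a bounded domain: a bounded, open, connected (in particular non-empty) set. -/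
structure IsBoundedDomain (Ω : Set (EuclideanSpace ℝ (Fin d))) : Prop where
  isOpen : IsOpen Ω
  isConnected : IsConnected Ω
  isBounded : Bornology.IsBounded Ω

/-- `ψ ∈ C_c^∞(Ω)`. -/
structure IsTestFunction (Ω : Set (EuclideanSpace ℝ (Fin d)))
    (ψ : EuclideanSpace ℝ (Fin d) → ℝ) : Prop where
  contDiff : ContDiff ℝ ∞ ψ
  hasCompactSupport : HasCompactSupport ψ
  tsupport_subset : tsupport ψ ⊆ Ω

/-- `g` is a weak (distributional) gradient of `u` on `Ω`. -/
structure HasWeakGradient (Ω : Set (EuclideanSpace ℝ (Fin d)))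
    (u : EuclideanSpace ℝ (Fin d) → ℝ)
    (g : EuclideanSpace ℝ (Fin d) → EuclideanSpace ℝ (Fin d)) : Prop where
  locallyIntegrableOn : LocallyIntegrableOn u Ω
  locallyIntegrableOn_grad : LocallyIntegrableOn g Ω
  integral_eq : ∀ ψ, IsTestFunction Ω ψ →
    ∫ x in Ω, u x • gradient ψ x = - ∫ x in Ω, ψ x • g x

/-- A weak gradient on an open set is unique up to equality almost everywhere. -/
theorem HasWeakGradient.ae_eq {Ω : Set (EuclideanSpace ℝ (Fin d))} (hΩ : IsOpen Ω)
    {u : EuclideanSpace ℝ (Fin d) → ℝ}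
    {g h : EuclideanSpace ℝ (Fin d) → EuclideanSpace ℝ (Fin d)}
    (hg : HasWeakGradient Ω u g) (hh : HasWeakGradient Ω u h) :
    g =ᵐ[volume.restrict Ω] h := by
  have key : ∀ᵐ x ∂volume, x ∈ Ω → (g - h) x = 0 := by
    refine hΩ.ae_eq_zero_of_integral_contDiff_smul_eq_zero
      (hg.locallyIntegrableOn_grad.sub hh.locallyIntegrableOn_grad) ?_
    intro ψ h1 h2 h3
    have hψ : IsTestFunction Ω ψ := ⟨h1, h2, h3⟩
    have int_of : ∀ f : EuclideanSpace ℝ (Fin d) → EuclideanSpace ℝ (Fin d),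
        LocallyIntegrableOn f Ω → IntegrableOn (fun x => ψ x • f x) Ω := by
      intro f hf
      have hK : IntegrableOn f (tsupport ψ) := hf.integrableOn_compact_subset h3 h2
      have h4 : IntegrableOn (fun x => ψ x • f x) (tsupport ψ) :=
        hK.continuousOn_smul h1.continuous.continuousOn h2
      have h5 : Integrable (fun x => ψ x • f x) := by
        rw [← integrableOn_iff_integrable_of_support_subset (s := tsupport ψ)]
        · exact h4
        · intro x hx
          apply subset_tsupport ψ
          intro h0
          exact hx (by simp [h0])
      exact h5.integrableOn
    have e1 := hg.integral_eq ψ hψ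
    have e2 := hh.integral_eq ψ hψ
    have e3 : ∫ x in Ω, ψ x • (g - h) x = 0 := by
      simp only [Pi.sub_apply, smul_sub]
      rw [integral_sub (int_of g hg.locallyIntegrableOn_grad)
        (int_of h hh.locallyIntegrableOn_grad)]
      rw [e1] at e2
      rw [neg_injective e2, sub_self]
    rw [← setIntegral_eq_integral_of_forall_compl_eq_zero (s := Ω)]
    · exact e3
    · intro x hx
      have : ψ x = 0 := image_eq_zero_of_notMem_tsupport (fun hx' => hx (h3 hx'))
      simp [this]
  filter_upwards [(ae_restrict_iff' hΩ.measurableSet).2 key] with x hx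
  exact sub_eq_zero.1 hx

open Classical in
/-- The weak gradient `∇u` on `Ω` (unique almost everywhere, by `HasWeakGradient.ae_eq`);
the value is `0` if `u` has no weak gradient on `Ω`. -/
def weakGradient (Ω : Set (EuclideanSpace ℝ (Fin d))) (u : EuclideanSpace ℝ (Fin d) → ℝ) :
    EuclideanSpace ℝ (Fin d) → EuclideanSpace ℝ (Fin d) :=
  if h : ∃ g, HasWeakGradient Ω u g then h.choose else 0

/-- `u ∈ H^1(Ω)`: `u` and its weak gradient are square integrable on `Ω`. -/
structure MemH1 (Ω : Set (EuclideanSpace ℝ (Fin d)))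
    (u : EuclideanSpace ℝ (Fin d) → ℝ) : Prop where
  memLp : MemLp u 2 (volume.restrict Ω)
  hasWeakGradient : HasWeakGradient Ω u (weakGradient Ω u)
  memLp_grad : MemLp (weakGradient Ω u) 2 (volume.restrict Ω)

/-- `u ∈ H^1_0(Ω)`: `u ∈ H^1(Ω)` is a limit of functions in `C_c^∞(Ω)` for the `H^1(Ω)` norm. -/
structure MemH10 (Ω : Set (EuclideanSpace ℝ (Fin d)))
    (u : EuclideanSpace ℝ (Fin d) → ℝ) : Prop where
  memH1 : MemH1 Ω u
  exists_approx : ∃ ψ : ℕ → EuclideanSpace ℝ (Fin d) → ℝ, (∀ n, IsTestFunction Ω (ψ n)) ∧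
    Tendsto (fun n => eLpNorm (fun x => ψ n x - u x) 2 (volume.restrict Ω)) atTop (𝓝 0) ∧
    Tendsto (fun n => eLpNorm (fun x => gradient (ψ n) x - weakGradient Ω u x) 2
      (volume.restrict Ω)) atTop (𝓝 0)

/-- `u` is in the domain of the Dirichlet Laplacian `-Δ` on `Ω` and `-Δ u = f`: the self-adjoint
operator on `L²(Ω)` associated with the quadratic form `∫ |∇u|²` on `H^1_0(Ω)`. -/
structure IsDirichletLaplacian (Ω : Set (EuclideanSpace ℝ (Fin d)))
    (u f : EuclideanSpace ℝ (Fin d) → ℝ) : Prop where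
  memH10 : MemH10 Ω u
  memLp : MemLp f 2 (volume.restrict Ω)
  integral_eq : ∀ w, MemH10 Ω w →
    ∫ x in Ω, inner ℝ (weakGradient Ω u x) (weakGradient Ω w x) = ∫ x in Ω, f x * w x

/-- `v` is an eigenfunction (so `v ≠ 0`) of the Dirichlet Laplacian on `Ω`, with eigenvalue `μ`. -/
structure IsDirichletEigenfunction (Ω : Set (EuclideanSpace ℝ (Fin d)))
    (μ : ℝ) (v : EuclideanSpace ℝ (Fin d) → ℝ) : Prop where
  isDirichletLaplacian : IsDirichletLaplacian Ω v (fun x => μ * v x)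
  ne_zero : ¬ (v =ᵐ[volume.restrict Ω] 0)

/-- `ev 0 ≤ ev 1 ≤ ⋯` lists the eigenvalues of the Dirichlet Laplacian on `Ω`, repeated according
to multiplicity, and `u 0, u 1, …` are corresponding `L²(Ω)`-orthonormal eigenfunctions.
(`ev j` and `u j` are `λ_{j+1}` and `u_{j+1}` in the numbering that starts from `1`.)
The last field says that the list is exhaustive: since eigenfunctions for different eigenvalues are
orthogonal, it means that the `u j` with `ev j = μ` span the eigenspace of `μ`, for each `μ`. -/
structure IsDirichletEigensystem (Ω : Set (EuclideanSpace ℝ (Fin d)))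
    (ev : ℕ → ℝ) (u : ℕ → EuclideanSpace ℝ (Fin d) → ℝ) : Prop where
  monotone : Monotone ev
  isEigenfunction : ∀ j, IsDirichletEigenfunction Ω (ev j) (u j)
  orthonormal : ∀ i j, ∫ x in Ω, u i x * u j x = if i = j then 1 else 0
  exhaustive : ∀ μ v, IsDirichletEigenfunction Ω μ v → ∃ j, ∫ x in Ω, v x * u j x ≠ 0

/-- `‖f‖₂²`, the squared norm of `f` in `L²(Ω)`, for scalar or vector valued `f`. -/
def sqNorm {F : Type*} [NormedAddCommGroup F] (Ω : Set (EuclideanSpace ℝ (Fin d)))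
    (f : EuclideanSpace ℝ (Fin d) → F) : ℝ :=
  ∫ x in Ω, ‖f x‖ ^ 2

/-- `‖f‖_∞`, the norm of `f` in `L^∞(Ω)`. -/
def supNorm (Ω : Set (EuclideanSpace ℝ (Fin d))) (f : EuclideanSpace ℝ (Fin d) → ℝ) : ℝ :=
  (eLpNorm f ∞ (volume.restrict Ω)).toReal

/-- `ω_d = π^{d/2} / Γ(1 + d/2)`, the volume of the unit ball of `ℝ^d`. -/
def unitBallVolume (d : ℕ) : ℝ :=
  Real.pi ^ ((d : ℝ) / 2) / Real.Gamma (1 + (d : ℝ) / 2)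

/-- The classical constant `C_d = 4 π² ω_d^{-2/d}`. -/
def classicalConst (d : ℕ) : ℝ :=
  4 * Real.pi ^ 2 * unitBallVolume d ^ (-(2 / (d : ℝ)))

/-- `ρ(φ) = ‖φ‖₂² / (|Ω| ‖φ‖_∞²)`. -/
def rho (Ω : Set (EuclideanSpace ℝ (Fin d))) (φ : EuclideanSpace ℝ (Fin d) → ℝ) : ℝ :=
  sqNorm Ω φ / (volume.real Ω * supNorm Ω φ ^ 2)

end DirichletRiesz

end

/-! Modulate `φ` by a plane wave: `f_ξ(x) = exp(2πi⟨x, ξ⟩) φ(x)` stays in `H^1_0(Ω)`, and its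
coefficient on `u_j` is, up to conjugation, the Fourier transform of `φ u_j` at `ξ`. Parseval for
the eigenbasis gives `∑ |⟨f_ξ, u_j⟩|² = ‖φ‖²` and `∑ λ_j |⟨f_ξ, u_j⟩|² = ‖∇φ‖² + 4π²|ξ|²‖φ‖²`, the
cross term vanishing because `φ` is real (`hasSum_fourierSq`). Since `z - λ_j ≤ (z - λ_j)_+`, the
sum `∑ (z - λ_j)_+ |⟨f_ξ, u_j⟩|²` is at least `(z‖φ‖² - ‖∇φ‖² - 4π²|ξ|²‖φ‖²)_+`. Integration over
`ξ` turns the left side into the weighted Riesz mean, by Plancherel, and the right side into the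
integral of a truncated paraboloid (`integral_le_riesz`, `integral_max_sub_norm_sq`). Sines and
cosines replace the exponential, so that all functions stay real.

Part 2 takes `z = λ_k`, bounds `‖φ u_j‖²` by `‖φ‖_∞²` and optimises by a Legendre transform
(`mul_le_add_of_rpow`). In part 3, `ρ = 1` would make `φ²` constant, which is impossible for a
nonzero function of `H^1_0(Ω)`.

Parseval is not part of the definition of an eigensystem. It follows from the spectral theorem, once
the embedding of `H^1_0(Ω)` into `L²(Ω)` is known to be compact (`isCompactOperator_embL2`, proved
by Fourier analysis), and from exhaustiveness of the list. -/

noncomputable section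

namespace DirichletRiesz

/-! ### Eigenvectors of `J† J` for an operator `J` between Hilbert spaces. -/

section Hilbert

variable {W L : Type*} [NormedAddCommGroup W] [InnerProductSpace ℝ W]
  [NormedAddCommGroup L] [InnerProductSpace ℝ L]

variable {J : W →L[ℝ] L} {e : ℕ → W} {κ : ℕ → ℝ}

/-- `hT` is the weak form of `J† J e_j = κ_j e_j`, whence `‖e_j‖² = 1/κ_j`. Later `J` is the
embedding of `H^1_0(Ω)` into `L²(Ω)` and `κ_j = 1/(1 + λ_j)`. -/
theorem orthonormal_sqrt_smul (hκ : ∀ j, 0 < κ j)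
    (hT : ∀ j w, inner ℝ (J (e j)) (J w) = κ j * inner ℝ (e j) w)
    (ho : Orthonormal ℝ (fun j => J (e j))) :
    Orthonormal ℝ (fun j => √(κ j) • e j) := by
  rw [orthonormal_iff_ite] at ho ⊢
  intro i j
  have h1 := ho i j
  rw [hT] at h1
  simp only [inner_smul_left, inner_smul_right, RCLike.conj_to_real]
  have h2 : inner ℝ (e i) (e j) = (if i = j then 1 else 0) / κ i := by
    rw [← h1]; field_simp [(hκ i).ne']
  rw [h2]
  split_ifs with hij
  · subst hij
    rw [← mul_assoc, Real.mul_self_sqrt (hκ i).le]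
    field_simp [(hκ i).ne']
  · simp

/-- The eigenvalues of `J† J` cannot stay away from `0` for a compact `J`. -/
theorem exists_lt_of_isCompactOperator (hJ : IsCompactOperator J) (hκ : ∀ j, 0 < κ j)
    (hT : ∀ j w, inner ℝ (J (e j)) (J w) = κ j * inner ℝ (e j) w)
    (ho : Orthonormal ℝ (fun j => J (e j))) {c : ℝ} (hc : 0 < c) : ∃ j, κ j < c := by
  by_contra! hge
  have hb := orthonormal_sqrt_smul hκ hT ho
  have hK := hJ.isCompact_closure_image_closedBall (𝕜₁ := ℝ) 1
  obtain ⟨y, -, s, hs, hy⟩ := hK.tendsto_subseq (x := fun j => J (√(κ j) • e j)) fun j =>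
    subset_closure ⟨_, by simp [hb.1 j], rfl⟩
  have hcau := hy.cauchySeq
  rw [Metric.cauchySeq_iff] at hcau
  obtain ⟨N, hN⟩ := hcau (√c) (Real.sqrt_pos.2 hc)
  have h1 := hN N le_rfl (N + 1) (by omega)
  have hne : s N ≠ s (N + 1) := hs.injective.ne (by omega)
  simp only [Function.comp, dist_eq_norm, map_smul] at h1
  rw [orthonormal_iff_ite] at ho
  -- The images of two distinct vectors of the orthonormal system are at squared distance `κ_i + κ_j
  -- ≥ 2c`, so no subsequence of the images is Cauchy.
  have h2 : ‖√(κ (s N)) • J (e (s N)) - √(κ (s (N + 1))) • J (e (s (N + 1)))‖ ^ 2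
      = κ (s N) + κ (s (N + 1)) := by
    rw [norm_sub_sq_real, norm_smul, norm_smul, inner_smul_left, inner_smul_right, ho, if_neg hne]
    have h4 : ∀ j, ‖J (e j)‖ = 1 := fun j => by
      have := ho j j
      rw [if_pos rfl, real_inner_self_eq_norm_sq] at this
      exact (pow_eq_one_iff_of_nonneg (norm_nonneg _) two_ne_zero).1 this
    simp [h4, Real.sq_sqrt (hκ _).le]
  have h3 := pow_lt_pow_left₀ h1 (norm_nonneg _) two_ne_zero
  rw [h2, Real.sq_sqrt hc.le] at h3
  linarith [hge (s N), hκ (s (N + 1))]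

variable [CompleteSpace W] [CompleteSpace L]

/-- An operator that is small on subspaces of finite codimension is compact. -/
theorem isCompactOperator_of_forall_small_on_orthogonal 
    (h : ∀ ε : ℝ, 0 < ε → ∃ S : Submodule ℝ L, FiniteDimensional ℝ S ∧
      ∀ w, J w ∈ Sᗮ → ‖J w‖ ≤ ε * ‖w‖) : IsCompactOperator J := by
  have hcl := isClosed_setOfPred_isCompactOperator (σ₁₂ := RingHom.id ℝ) (M₁ := W) (M₂ := L)
  refine hcl.closure_subset (a := J) (Metric.mem_closure_iff.2 fun ε hε => ?_)
  obtain ⟨S, hS, hJ⟩ := h (ε / 2) (by positivity)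
  -- With `K` the kernel of `P_S J`, the map `P_S J` is injective on `Kᗮ`, so `Kᗮ` is
  -- finite-dimensional. Then `J P_{Kᗮ}` has finite rank, and it differs from `J` by `J P_K`, of
  -- norm at most `ε / 2`.
  let Λ : W →L[ℝ] S := S.orthogonalProjectionOnto ∘L J
  let K : Submodule ℝ W := Λ.ker
  have hKc : IsClosed (K : Set W) := Λ.isClosed_ker
  have : CompleteSpace K := hKc.completeSpace_coe
  have hfin : FiniteDimensional ℝ Kᗮ := by
    refine FiniteDimensional.of_injective ((Λ : W →ₗ[ℝ] S) ∘ₗ Kᗮ.subtype) ?_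
    rw [injective_iff_map_eq_zero]
    intro a ha
    have h1 : (a : W) ∈ K := ha
    have h2 : (a : W) ∈ K ⊓ Kᗮ := ⟨h1, a.2⟩
    rw [K.inf_orthogonal_eq_bot] at h2
    exact Subtype.ext ((Submodule.mem_bot ℝ).1 h2)
  refine ⟨(J ∘L Kᗮ.subtypeL) ∘L Kᗮ.orthogonalProjectionOnto, ?_, ?_⟩
  · have : ProperSpace Kᗮ := FiniteDimensional.proper ℝ Kᗮ
    exact (isCompactOperator_of_locallyCompactSpace_dom
      Kᗮ.orthogonalProjectionOnto).clm_comp (J ∘L Kᗮ.subtypeL)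
  · rw [dist_eq_norm]
    refine lt_of_le_of_lt (ContinuousLinearMap.opNorm_le_bound _ (half_pos hε).le fun w => ?_)
      (half_lt_self hε)
    have e : (J - (J ∘L Kᗮ.subtypeL) ∘L Kᗮ.orthogonalProjectionOnto) w
        = J (K.orthogonalProjectionOnto w) := by
      have := K.starProjection_add_starProjection_orthogonal w
      simp only [sub_apply, ContinuousLinearMap.comp_apply,
        Submodule.subtypeL_apply]
      rw [← map_sub]
      congr 1
      rw [sub_eq_iff_eq_add]
      exact this.symm
    rw [e]
    refine (hJ _ ?_).trans ?_
    · have h1 : Λ (K.orthogonalProjectionOnto w) = 0 := (K.orthogonalProjectionOnto w).2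
      exact S.orthogonalProjectionOnto_eq_zero_iff.1 h1
    · gcongr
      exact K.norm_orthogonalProjectionOnto_apply_le w

/-- A complete system of eigenvectors of `J† J` for a compact injective `J` is total. -/
theorem span_orthogonal_eq_bot_of_exhaustive (hJ : IsCompactOperator J)
    (hinj : ∀ w, J w = 0 → w = 0) (hκ : ∀ j, 0 < κ j)
    (hT : ∀ j w, inner ℝ (J (e j)) (J w) = κ j * inner ℝ (e j) w)
    (hex : ∀ v ≠ 0, ∀ c : ℝ, 0 < c → (∀ w, inner ℝ (J v) (J w) = c * inner ℝ v w) →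
      ∃ j, inner ℝ (J v) (J (e j)) ≠ 0) :
    (Submodule.span ℝ (Set.range fun j => √(κ j) • e j))ᗮ = ⊥ := by
  -- `J† J` leaves `M` invariant. By exhaustiveness it has no eigenvector in `M`, and the spectral
  -- theorem for compact symmetric operators then forces `M = 0`.
  let M : Submodule ℝ W := (Submodule.span ℝ (Set.range fun j => √(κ j) • e j))ᗮ
  have hM : ∀ w, w ∈ M ↔ ∀ j, inner ℝ (J (e j)) (J w) = 0 := by
    intro w
    rw [Submodule.mem_orthogonal]
    constructor
    · intro h j
      have := h _ (Submodule.subset_span ⟨j, rfl⟩)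
      rw [inner_smul_left] at this
      rw [hT]
      simpa [(Real.sqrt_pos.2 (hκ j)).ne', (hκ j).ne'] using this
    · intro h v hv
      induction hv using Submodule.span_induction with
      | mem x hx =>
        obtain ⟨j, rfl⟩ := hx
        have := h j
        rw [hT] at this
        simp only [inner_smul_left, (mul_eq_zero.1 this).resolve_left (hκ j).ne', mul_zero]
      | zero => simp
      | add x y _ _ hx hy => rw [inner_add_left, hx, hy, add_zero]
      | smul a x _ hx => rw [inner_smul_left, hx, mul_zero]
  let T : W →L[ℝ] W := J.adjoint ∘L J
  have hTi : ∀ v w, inner ℝ (T v) w = inner ℝ (J v) (J w) := fun v w => by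
    simp [T, ContinuousLinearMap.adjoint_inner_left]
  have hTsymm : T.IsSymmetric := fun v w => by
    change inner ℝ (T v) w = inner ℝ v (T w)
    rw [hTi, real_inner_comm, ← hTi, real_inner_comm]
  have hTc : IsCompactOperator T := hJ.clm_comp J.adjoint
  have hinv : ∀ v ∈ M, T v ∈ M := by
    intro v hv
    rw [hM] at hv ⊢
    intro j
    rw [hT, real_inner_comm, hTi, real_inner_comm, hv j, mul_zero]
  have hMc : CompleteSpace M := inferInstance
  let S : M →L[ℝ] M := T.restrict hinv
  have hSc : IsCompactOperator S := hTc.restrict' hinv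
  have hSs : S.IsSymmetric := hTsymm.restrict_invariant hinv
  have key := ContinuousLinearMap.orthogonalComplement_iSup_eigenspaces_eq_bot hSc hSs
  have hbot : ∀ c, Module.End.eigenspace (S : Module.End ℝ M) c = ⊥ := by
    intro c
    rw [Submodule.eq_bot_iff]
    intro v hv
    by_contra hv0
    have hv1 : T (v : W) = c • (v : W) := congrArg Subtype.val (Module.End.mem_eigenspace_iff.1 hv)
    have hvW : (v : W) ≠ 0 := fun h => hv0 (Subtype.ext h)
    have hw : ∀ w, inner ℝ (J v) (J w) = c * inner ℝ (v : W) w := fun w => by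
      rw [← hTi, hv1, inner_smul_left]; simp
    -- Injectivity of `J` excludes the eigenvalue `0`, to which `hex` does not apply.
    have hc : 0 < c := by
      have h1 := hw v
      rw [real_inner_self_eq_norm_sq, real_inner_self_eq_norm_sq] at h1
      have h2 : 0 < ‖J v‖ := norm_pos_iff.2 fun h => hvW (hinj _ h)
      have h3 : 0 < ‖(v : W)‖ := norm_pos_iff.2 hvW
      by_contra hc
      have := mul_nonpos_of_nonpos_of_nonneg (not_lt.1 hc) (sq_nonneg ‖(v : W)‖)
      have := pow_pos h2 2
      linarith
    obtain ⟨j, hj⟩ := hex v hvW c hc hw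
    rw [real_inner_comm] at hj
    exact hj ((hM v).1 v.2 j)
  simp only [hbot, iSup_bot, Submodule.bot_orthogonal_eq_top] at key
  rw [Submodule.eq_bot_iff]
  intro x hx
  have : (⟨x, hx⟩ : M) ∈ (⊤ : Submodule ℝ M) := trivial
  rw [key] at this
  exact congrArg Subtype.val ((Submodule.mem_bot ℝ).1 this)

/-- Parseval identities in both Hilbert spaces for a complete system of eigenvectors. -/
theorem hasSum_of_exhaustive (hJ : IsCompactOperator J)
    (hinj : ∀ w, J w = 0 → w = 0) (hκ : ∀ j, 0 < κ j)
    (hT : ∀ j w, inner ℝ (J (e j)) (J w) = κ j * inner ℝ (e j) w)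
    (ho : Orthonormal ℝ (fun j => J (e j)))
    (hex : ∀ v ≠ 0, ∀ c : ℝ, 0 < c → (∀ w, inner ℝ (J v) (J w) = c * inner ℝ v w) →
      ∃ j, inner ℝ (J v) (J (e j)) ≠ 0) (w : W) :
    HasSum (fun j => inner ℝ (J (e j)) (J w) ^ 2) (‖J w‖ ^ 2) ∧
    HasSum (fun j => (κ j)⁻¹ * inner ℝ (J (e j)) (J w) ^ 2) (‖w‖ ^ 2) := by
  let b : HilbertBasis ℕ ℝ W := HilbertBasis.mkOfOrthogonalEqBot
    (orthonormal_sqrt_smul hκ hT ho) (span_orthogonal_eq_bot_of_exhaustive hJ hinj hκ hT hex)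
  have hb : ∀ j, b j = √(κ j) • e j := fun j => by
    simp only [b]; rw [HilbertBasis.coe_mkOfOrthogonalEqBot]
  have hbi : ∀ j, inner ℝ (b j) w = √(κ j) * (κ j)⁻¹ * inner ℝ (J (e j)) (J w) := fun j => by
    rw [hb, inner_smul_left, hT]
    have := (hκ j).ne'
    simp only [RCLike.conj_to_real]
    field_simp
  constructor
  -- The functional `⟨J w, J ·⟩` is applied to the expansion of `w` in `W`, so completeness of the
  -- `J e_j` in `L` is not needed.
  · have h1 := (b.hasSum_repr w).mapL ((innerSL ℝ (J w)) ∘L J)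
    simp only [ContinuousLinearMap.comp_apply, innerSL_apply_apply, map_smul,
      real_inner_self_eq_norm_sq] at h1
    refine h1.congr_fun ?_
    intro j
    rw [HilbertBasis.repr_apply_apply, hbi, hb, map_smul, real_inner_comm]
    simp only [smul_eq_mul, inner_smul_right]
    have h2 := Real.mul_self_sqrt (hκ j).le
    have h3 := (hκ j).ne'
    rw [real_inner_comm (J (e j)) (J w)]
    field_simp
    linear_combination (-(inner ℝ (J (e j)) (J w) ^ 2)) * h2
  · have h1 := b.hasSum_inner_mul_inner w w
    rw [real_inner_self_eq_norm_sq] at h1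
    refine h1.congr_fun ?_
    intro j
    rw [real_inner_comm (b j) w, hbi]
    have h2 := Real.mul_self_sqrt (hκ j).le
    have h3 := (hκ j).ne'
    field_simp
    linear_combination (-(inner ℝ (J (e j)) (J w) ^ 2)) * h2

end Hilbert

/-! ### Plancherel's theorem for Fourier integrals of real functions. -/

section Plancherel

variable {V : Type*} [NormedAddCommGroup V] [InnerProductSpace ℝ V] [FiniteDimensional ℝ V]
  [MeasurableSpace V] [BorelSpace V]

open FourierTransform SchwartzMap in
/-- The `L²` Fourier transform agrees with the Fourier integral on `L¹ ∩ L²`. -/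
theorem fourier_toLp_ae_eq {f : V → ℂ} (h1 : Integrable f) (h2 : MemLp f 2) :
    ((𝓕 (h2.toLp f) : Lp ℂ 2 (volume : Measure V)) : V → ℂ) =ᵐ[volume] 𝓕 f := by
  have hcont : Continuous (𝓕 f) :=
    VectorFourier.fourierIntegral_continuous Real.continuous_fourierChar continuous_inner h1
  refine ae_eq_of_integral_contDiff_smul_eq
    ((Lp.memLp _).locallyIntegrable (by norm_num)) hcont.locallyIntegrable ?_
  intro g g_smooth g_cpt
  have hg₁ : HasCompactSupport (Complex.ofRealCLM ∘ g) := g_cpt.comp_left rfl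
  have hg₂ : ContDiff ℝ ∞ (Complex.ofRealCLM ∘ g) := by fun_prop
  -- Against a Schwartz function both transforms are moved to the other side: the `L²` one through
  -- tempered distributions, the integral one by Fubini.
  let G : 𝓢(V, ℂ) := hg₁.toSchwartzMap hg₂
  have hG : ∀ x, G x = (g x : ℂ) := fun x => rfl
  have e1 := congrArg (fun F : 𝓢'(V, ℂ) => F G)
    (Lp.fourier_toTemperedDistribution_eq (h2.toLp f))
  simp only [TemperedDistribution.fourier_apply, Lp.toTemperedDistribution_apply] at e1
  have e2 : ∫ x, (𝓕 G) x • (h2.toLp f : V → ℂ) x = ∫ x, f x • (𝓕 (G : V → ℂ)) x := by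
    refine integral_congr_ae ?_
    filter_upwards [h2.coeFn_toLp] with x hx
    rw [hx, SchwartzMap.fourier_coe, smul_eq_mul, smul_eq_mul, mul_comm]
  have e3 := VectorFourier.integral_fourierIntegral_smul_eq_flip (L := innerₗ V)
    (μ := volume) (ν := volume) Real.continuous_fourierChar continuous_inner h1
    (G.integrable (μ := volume))
  rw [flip_innerₗ] at e3
  have e4 : ∫ x, (𝓕 f) x • G x = ∫ x, f x • (𝓕 (G : V → ℂ)) x := e3
  calc ∫ x, g x • ((𝓕 (h2.toLp f) : Lp ℂ 2 (volume : Measure V)) : V → ℂ) x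
      = ∫ x, G x • ((𝓕 (h2.toLp f) : Lp ℂ 2 (volume : Measure V)) : V → ℂ) x := by simp [hG]
    _ = ∫ x, (𝓕 f) x • G x := by rw [← e1, e2, e4]
    _ = ∫ x, g x • 𝓕 f x := by simp [hG, mul_comm]

open FourierTransform in
/-- Plancherel's theorem for the Fourier integral on `L¹ ∩ L²`. -/
theorem integrable_and_integral_norm_sq_fourier {f : V → ℂ} (h1 : Integrable f) (h2 : MemLp f 2) :
    Integrable (fun ξ => ‖𝓕 f ξ‖ ^ 2) ∧ ∫ ξ, ‖𝓕 f ξ‖ ^ 2 = ∫ x, ‖f x‖ ^ 2 := by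
  have hae := fourier_toLp_ae_eq h1 h2
  have hm : MemLp (𝓕 f) 2 := (memLp_congr_ae hae).1 (Lp.memLp _)
  refine ⟨(memLp_two_iff_integrable_sq_norm hm.1).1 hm, ?_⟩
  have key := Lp.norm_fourier_eq (h2.toLp f)
  have hn : ∀ F : Lp (α := V) ℂ 2, ‖F‖ ^ 2 = ∫ x, ‖F x‖ ^ 2 := fun F => by
    rw [← inner_self_eq_norm_sq (𝕜 := ℂ), L2.inner_def, ← integral_re (L2.integrable_inner F F)]
    simp only [inner_self_eq_norm_sq]
  have h3 := hn (𝓕 (h2.toLp f))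
  rw [key, hn] at h3
  rw [← integral_congr_ae (h2.coeFn_toLp.mono fun x hx => congrArg (fun t => ‖t‖ ^ 2) hx), h3]
  exact (integral_congr_ae (hae.mono fun x hx => congrArg (fun t => ‖t‖ ^ 2) hx)).symm

/-- The squared modulus of the Fourier integral over `A` of a real function `v`. -/
def fourierSq (A : Set V) (v : V → ℝ) (ξ : V) : ℝ :=
  (∫ x in A, v x * Real.cos (2 * Real.pi * inner ℝ x ξ)) ^ 2
    + (∫ x in A, v x * Real.sin (2 * Real.pi * inner ℝ x ξ)) ^ 2

theorem fourierSq_nonneg (A : Set V) (v : V → ℝ) (ξ : V) : 0 ≤ fourierSq A v ξ := by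
  unfold fourierSq; positivity

/-- Plancherel's theorem for real functions in `L²` of a set of finite measure. -/
theorem integrable_and_integral_fourierSq {A : Set V} (hA : MeasurableSet A)
    (hfin : volume A ≠ ⊤) {v : V → ℝ} (hv : MemLp v 2 (volume.restrict A)) :
    Integrable (fourierSq A v) ∧ ∫ ξ, fourierSq A v ξ = ∫ x in A, v x ^ 2 := by
  have : IsFiniteMeasure (volume.restrict A) := ⟨by simpa using hfin.lt_top⟩
  have hv1 : Integrable v (volume.restrict A) := hv.integrable (by norm_num)
  let f : V → ℂ := A.indicator (fun x => (v x : ℂ))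
  have hf1 : Integrable f := (integrable_indicator_iff hA).2 hv1.ofReal
  have hf2 : MemLp f 2 := (memLp_indicator_iff_restrict hA).2 hv.ofReal
  have hF : ∀ ξ, ‖FourierTransform.fourier f ξ‖ ^ 2 = fourierSq A v ξ := by
    intro ξ
    have h0 : FourierTransform.fourier f ξ =
        ∫ x in A, ((v x * Real.cos (2 * Real.pi * inner ℝ x ξ) : ℝ) : ℂ)
          + ((-(v x * Real.sin (2 * Real.pi * inner ℝ x ξ)) : ℝ) : ℂ) * Complex.I := by
      rw [Real.fourier_eq', ← integral_indicator hA]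
      refine integral_congr_ae (ae_of_all _ fun x => ?_)
      by_cases hx : x ∈ A
      · simp only [f, Set.indicator_of_mem hx]
        rw [Complex.exp_mul_I, smul_eq_mul, ← Complex.ofReal_cos, ← Complex.ofReal_sin]
        rw [show -2 * Real.pi * inner ℝ x ξ = -(2 * Real.pi * inner ℝ x ξ) by ring, Real.cos_neg,
          Real.sin_neg]
        push_cast
        ring
      · simp [f, Set.indicator_of_notMem hx]
    have hc : Integrable (fun x => v x * Real.cos (2 * Real.pi * inner ℝ x ξ))
        (volume.restrict A) :=
      hv1.mul_bdd (c := 1) (by fun_prop) (ae_of_all _ fun x => Real.abs_cos_le_one _)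
    have hs : Integrable (fun x => v x * Real.sin (2 * Real.pi * inner ℝ x ξ))
        (volume.restrict A) :=
      hv1.mul_bdd (c := 1) (by fun_prop) (ae_of_all _ fun x => Real.abs_sin_le_one _)
    rw [h0, integral_add hc.ofReal (hs.neg.ofReal.mul_const _), integral_mul_const,
      integral_complex_ofReal, integral_complex_ofReal, Complex.sq_norm, Complex.normSq_add_mul_I, integral_neg,
      neg_sq, fourierSq]
  have key := integrable_and_integral_norm_sq_fourier hf1 hf2
  simp only [hF] at key
  refine ⟨key.1, key.2.trans ?_⟩
  rw [← integral_indicator hA]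
  refine integral_congr_ae (ae_of_all _ fun x => ?_)
  by_cases hx : x ∈ A <;> simp [f, hx]

end Plancherel

/-! ### Inner products and limits in `L²`. -/

section SquareIntegrable

variable {α F : Type*} [MeasurableSpace α] {μ : Measure α} [NormedAddCommGroup F]

theorem norm_toLp_sq [InnerProductSpace ℝ F] {f : α → F} (hf : MemLp f 2 μ) :
    ‖hf.toLp f‖ ^ 2 = ∫ x, ‖f x‖ ^ 2 ∂μ := by
  rw [← real_inner_self_eq_norm_sq, L2.inner_def]
  refine integral_congr_ae (hf.coeFn_toLp.mono fun x hx => ?_)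
  simp only [hx, real_inner_self_eq_norm_sq]

theorem inner_toLp [InnerProductSpace ℝ F] {f g : α → F} (hf : MemLp f 2 μ) (hg : MemLp g 2 μ) :
    inner ℝ (hf.toLp f) (hg.toLp g) = ∫ x, inner ℝ (f x) (g x) ∂μ := by
  rw [L2.inner_def]
  refine integral_congr_ae ?_
  filter_upwards [hf.coeFn_toLp, hg.coeFn_toLp] with x h1 h2
  rw [h1, h2]

theorem integrable_inner_of_memLp [InnerProductSpace ℝ F] {f g : α → F} (hf : MemLp f 2 μ)
    (hg : MemLp g 2 μ) : Integrable (fun x => inner ℝ (f x) (g x)) μ := by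
  refine (L2.integrable_inner (𝕜 := ℝ) (hf.toLp f) (hg.toLp g)).congr ?_
  filter_upwards [hf.coeFn_toLp, hg.coeFn_toLp] with x h1 h2
  rw [h1, h2]

theorem inner_toLp_real {f g : α → ℝ} (hf : MemLp f 2 μ) (hg : MemLp g 2 μ) :
    inner ℝ (hf.toLp f) (hg.toLp g) = ∫ x, f x * g x ∂μ := by
  rw [inner_toLp]
  exact integral_congr_ae (ae_of_all _ fun x => mul_comm _ _)

/-- The Cauchy-Schwarz inequality for integrals. -/
theorem sq_integral_mul_le {f g : α → ℝ} (hf : MemLp f 2 μ) (hg : MemLp g 2 μ) :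
    (∫ x, f x * g x ∂μ) ^ 2 ≤ (∫ x, f x ^ 2 ∂μ) * ∫ x, g x ^ 2 ∂μ := by
  have h := real_inner_mul_inner_self_le (hf.toLp f) (hg.toLp g)
  rw [inner_toLp_real, inner_toLp_real, inner_toLp_real] at h
  simpa only [sq] using h

theorem tendsto_integral_inner [InnerProductSpace ℝ F] {f g : ℕ → α → F} {f' g' : α → F}
    (hf : ∀ n, MemLp (f n) 2 μ) (hf' : MemLp f' 2 μ)
    (hg : ∀ n, MemLp (g n) 2 μ) (hg' : MemLp g' 2 μ)
    (h1 : Tendsto (fun n => eLpNorm (fun x => f n x - f' x) 2 μ) atTop (𝓝 0))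
    (h2 : Tendsto (fun n => eLpNorm (fun x => g n x - g' x) 2 μ) atTop (𝓝 0)) :
    Tendsto (fun n => ∫ x, inner ℝ (f n x) (g n x) ∂μ) atTop
      (𝓝 (∫ x, inner ℝ (f' x) (g' x) ∂μ)) := by
  have e1 := (Lp.tendsto_Lp_iff_tendsto_eLpNorm'' f hf f' hf').2 h1
  have e2 := (Lp.tendsto_Lp_iff_tendsto_eLpNorm'' g hg g' hg').2 h2
  have := e1.inner (𝕜 := ℝ) e2
  simpa only [inner_toLp] using this

theorem tendsto_eLpNorm_smul_sub [NormedSpace ℝ F] {f : ℕ → α → F} {f' : α → F} {ζ : α → ℝ}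
    {C : ℝ} (hC : ∀ᵐ x ∂μ, ‖ζ x‖ ≤ C)
    (h : Tendsto (fun n => eLpNorm (fun x => f n x - f' x) 2 μ) atTop (𝓝 0)) :
    Tendsto (fun n => eLpNorm (fun x => ζ x • f n x - ζ x • f' x) 2 μ) atTop (𝓝 0) := by
  have h2 : Tendsto (fun n => ENNReal.ofReal C * eLpNorm (fun x => f n x - f' x) 2 μ)
      atTop (𝓝 0) := by
    simpa using ENNReal.Tendsto.const_mul h (Or.inr ENNReal.ofReal_ne_top)
  refine tendsto_of_tendsto_of_tendsto_of_le_of_le tendsto_const_nhds h2 (fun _ => zero_le)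
    fun n => ?_
  refine eLpNorm_le_mul_eLpNorm_of_ae_le_mul (hC.mono fun x hx => ?_) 2
  rw [← smul_sub, norm_smul]
  gcongr

theorem tendsto_eLpNorm_add_sub {f g : ℕ → α → F} {f' g' : α → F}
    (hf : ∀ n, MemLp (f n) 2 μ) (hf' : MemLp f' 2 μ)
    (hg : ∀ n, MemLp (g n) 2 μ) (hg' : MemLp g' 2 μ)
    (h1 : Tendsto (fun n => eLpNorm (fun x => f n x - f' x) 2 μ) atTop (𝓝 0))
    (h2 : Tendsto (fun n => eLpNorm (fun x => g n x - g' x) 2 μ) atTop (𝓝 0)) :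
    Tendsto (fun n => eLpNorm (fun x => f n x + g n x - (f' x + g' x)) 2 μ) atTop (𝓝 0) := by
  have h3 := h1.add h2
  rw [add_zero] at h3
  refine tendsto_of_tendsto_of_tendsto_of_le_of_le tendsto_const_nhds h3 (fun _ => zero_le)
    fun n => ?_
  refine le_trans (le_of_eq ?_) (eLpNorm_add_le ((hf n).sub hf').1 ((hg n).sub hg').1 (by norm_num))
  congr 1
  funext x
  simp only [Pi.add_apply]
  abel

theorem MemLp.smul_of_bound [NormedSpace ℝ F] {f : α → F} (hf : MemLp f 2 μ) {ζ : α → ℝ} {C : ℝ}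
    (hζ : AEStronglyMeasurable ζ μ) (hC : ∀ᵐ x ∂μ, ‖ζ x‖ ≤ C) :
    MemLp (fun x => ζ x • f x) 2 μ :=
  hf.of_le_mul (c := C) (hζ.smul hf.1) (hC.mono fun x hx => by rw [norm_smul]; gcongr)

end SquareIntegrable

/-! ### Smooth functions, plane waves and test functions on `Ω`. -/

variable {d : ℕ} {Ω : Set (EuclideanSpace ℝ (Fin d))}

theorem exists_bound_on (hb : Bornology.IsBounded Ω) {F : Type*} [NormedAddCommGroup F]
    {f : EuclideanSpace ℝ (Fin d) → F} (hf : Continuous f) : ∃ C, ∀ x ∈ Ω, ‖f x‖ ≤ C := by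
  obtain ⟨C, hC⟩ := hb.isCompact_closure.exists_bound_of_continuousOn hf.continuousOn
  exact ⟨C, fun x hx => hC x (subset_closure hx)⟩

theorem ae_bound_on (hΩ : IsBoundedDomain Ω) {F : Type*} [NormedAddCommGroup F]
    {f : EuclideanSpace ℝ (Fin d) → F} (hf : Continuous f) :
    ∃ C, ∀ᵐ x ∂volume.restrict Ω, ‖f x‖ ≤ C := by
  obtain ⟨C, hC⟩ := exists_bound_on hΩ.isBounded hf
  exact ⟨C, (ae_restrict_mem hΩ.isOpen.measurableSet).mono hC⟩

theorem IsBoundedDomain.isFiniteMeasure (hΩ : IsBoundedDomain Ω) :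
    IsFiniteMeasure (volume.restrict Ω) :=
  ⟨by simpa using hΩ.isBounded.measure_lt_top⟩

theorem memLp_of_continuous (hΩ : IsBoundedDomain Ω) {F : Type*} [NormedAddCommGroup F]
    [SecondCountableTopology F]
    {f : EuclideanSpace ℝ (Fin d) → F} (hf : Continuous f) (p : ℝ≥0∞) :
    MemLp f p (volume.restrict Ω) := by
  have := hΩ.isFiniteMeasure
  obtain ⟨C, hC⟩ := ae_bound_on hΩ hf
  exact MemLp.of_bound hf.aestronglyMeasurable C hC

theorem continuous_gradient {f : EuclideanSpace ℝ (Fin d) → ℝ} (hf : ContDiff ℝ ∞ f) :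
    Continuous (gradient f) :=
  (InnerProductSpace.toDual ℝ _).symm.continuous.comp (hf.continuous_fderiv (by simp))

theorem gradient_mul {f g : EuclideanSpace ℝ (Fin d) → ℝ} (hf : ContDiff ℝ ∞ f)
    (hg : ContDiff ℝ ∞ g) (x : EuclideanSpace ℝ (Fin d)) :
    gradient (fun x => f x * g x) x = f x • gradient g x + g x • gradient f x := by
  refine ext_inner_right ℝ fun v => ?_
  have h1 : DifferentiableAt ℝ f x := hf.differentiable (by simp) x
  have h2 : DifferentiableAt ℝ g x := hg.differentiable (by simp) x
  rw [inner_add_left, inner_smul_left, inner_smul_left, inner_gradient_left, inner_gradient_left,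
    inner_gradient_left, fderiv_fun_mul h1 h2]
  simp

theorem gradient_cos (ξ x : EuclideanSpace ℝ (Fin d)) :
    gradient (fun x => Real.cos (2 * Real.pi * inner ℝ x ξ)) x
      = (-(2 * Real.pi * Real.sin (2 * Real.pi * inner ℝ x ξ))) • ξ := by
  refine ext_inner_right ℝ fun v => ?_
  have h : HasFDerivAt (fun x : EuclideanSpace ℝ (Fin d) => 2 * Real.pi * inner ℝ x ξ)
      ((2 * Real.pi) • innerSL ℝ ξ) x := by
    have := ((innerSL ℝ ξ).hasFDerivAt (x := x)).const_mul (2 * Real.pi)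
    simpa [real_inner_comm] using this
  rw [inner_gradient_left, h.cos.fderiv]
  simp [inner_smul_left]
  ring

theorem gradient_sin (ξ x : EuclideanSpace ℝ (Fin d)) :
    gradient (fun x => Real.sin (2 * Real.pi * inner ℝ x ξ)) x
      = (2 * Real.pi * Real.cos (2 * Real.pi * inner ℝ x ξ)) • ξ := by
  refine ext_inner_right ℝ fun v => ?_
  have h : HasFDerivAt (fun x : EuclideanSpace ℝ (Fin d) => 2 * Real.pi * inner ℝ x ξ)
      ((2 * Real.pi) • innerSL ℝ ξ) x := by
    have := ((innerSL ℝ ξ).hasFDerivAt (x := x)).const_mul (2 * Real.pi)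
    simpa [real_inner_comm] using this
  rw [inner_gradient_left, h.sin.fderiv]
  simp [inner_smul_left]
  ring

theorem contDiff_cos (ξ : EuclideanSpace ℝ (Fin d)) :
    ContDiff ℝ ∞ fun x => Real.cos (2 * Real.pi * inner ℝ x ξ) :=
  (contDiff_const.mul (contDiff_id.inner ℝ contDiff_const)).cos

theorem contDiff_sin (ξ : EuclideanSpace ℝ (Fin d)) :
    ContDiff ℝ ∞ fun x => Real.sin (2 * Real.pi * inner ℝ x ξ) :=
  (contDiff_const.mul (contDiff_id.inner ℝ contDiff_const)).sin

namespace IsTestFunction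

variable {ψ ζ : EuclideanSpace ℝ (Fin d) → ℝ}

theorem tsupport_gradient_subset (ψ : EuclideanSpace ℝ (Fin d) → ℝ) :
    tsupport (gradient ψ) ⊆ tsupport ψ := by
  refine closure_minimal (fun x hx => ?_) (isClosed_tsupport ψ)
  refine support_fderiv_subset ℝ (f := ψ) fun h => hx ?_
  simp [gradient, h]

theorem hasCompactSupport_gradient (hψ : IsTestFunction Ω ψ) : HasCompactSupport (gradient ψ) :=
  hψ.hasCompactSupport.of_isClosed_subset (isClosed_tsupport _) (tsupport_gradient_subset ψ)

theorem memLp (hψ : IsTestFunction Ω ψ) (p : ℝ≥0∞) : MemLp ψ p (volume.restrict Ω) :=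
  (hψ.contDiff.continuous.memLp_of_hasCompactSupport hψ.hasCompactSupport).restrict Ω

theorem memLp_gradient (hψ : IsTestFunction Ω ψ) (p : ℝ≥0∞) :
    MemLp (gradient ψ) p (volume.restrict Ω) :=
  ((continuous_gradient hψ.contDiff).memLp_of_hasCompactSupport
    hψ.hasCompactSupport_gradient).restrict Ω

theorem smooth_mul (hψ : IsTestFunction Ω ψ) (hζ : ContDiff ℝ ∞ ζ) :
    IsTestFunction Ω (fun x => ζ x * ψ x) where
  contDiff := hζ.mul hψ.contDiff
  hasCompactSupport := hψ.hasCompactSupport.mul_left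
  tsupport_subset := (tsupport_mul_subset_right (f := ζ) (g := ψ)).trans hψ.tsupport_subset

theorem add {φ : EuclideanSpace ℝ (Fin d) → ℝ} (hψ : IsTestFunction Ω ψ)
    (hφ : IsTestFunction Ω φ) : IsTestFunction Ω (fun x => ψ x + φ x) where
  contDiff := hψ.contDiff.add hφ.contDiff
  hasCompactSupport := hψ.hasCompactSupport.add hφ.hasCompactSupport
  tsupport_subset := (tsupport_add ψ φ).trans
    (Set.union_subset hψ.tsupport_subset hφ.tsupport_subset)

/-- Integration by parts against a test function. -/
theorem integral_by_parts (hψ : IsTestFunction Ω ψ) (hζ : ContDiff ℝ ∞ ζ)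
    (v : EuclideanSpace ℝ (Fin d)) :
    ∫ x in Ω, inner ℝ (gradient ψ x) (ζ x • v) = - ∫ x in Ω, ψ x * inner ℝ (gradient ζ x) v := by
  have hz : ∀ x ∉ Ω, ψ x = 0 := fun x hx =>
    image_eq_zero_of_notMem_tsupport fun h => hx (hψ.tsupport_subset h)
  have hz' : ∀ x ∉ Ω, gradient ψ x = 0 := fun x hx =>
    image_eq_zero_of_notMem_tsupport fun h =>
      hx (hψ.tsupport_subset (tsupport_gradient_subset ψ h))
  rw [setIntegral_eq_integral_of_forall_compl_eq_zero fun x hx => by rw [hz' x hx, inner_zero_left],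
    setIntegral_eq_integral_of_forall_compl_eq_zero fun x hx => by rw [hz x hx, zero_mul]]
  simp only [inner_smul_right, inner_gradient_left]
  have c1 := hψ.contDiff.continuous
  have c2 := hζ.continuous
  have c3 : Continuous fun x => fderiv ℝ ψ x v :=
    (hψ.contDiff.continuous_fderiv (by simp)).clm_apply continuous_const
  have c4 : Continuous fun x => fderiv ℝ ζ x v :=
    (hζ.continuous_fderiv (by simp)).clm_apply continuous_const
  have s3 : HasCompactSupport fun x => fderiv ℝ ψ x v := hψ.hasCompactSupport.fderiv_apply ℝ v
  rw [integral_mul_fderiv_eq_neg_fderiv_mul_of_integrable]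
  · simp only [mul_comm]
  · exact (c4.mul c1).integrable_of_hasCompactSupport hψ.hasCompactSupport.mul_left
  · exact (c2.mul c3).integrable_of_hasCompactSupport s3.mul_left
  · exact (c2.mul c1).integrable_of_hasCompactSupport hψ.hasCompactSupport.mul_left
  · exact fun x _ => hζ.differentiable (by simp) x
  · exact fun x _ => hψ.contDiff.differentiable (by simp) x

end IsTestFunction

/-! ### Calculus in `H^1_0(Ω)`. -/

/-- `(v, g)` is a limit of pairs `(ψ, ∇ψ)` with `ψ ∈ C_c^∞(Ω)`, in `L²(Ω)`. -/
structure IsH10Pair (Ω : Set (EuclideanSpace ℝ (Fin d))) (v : EuclideanSpace ℝ (Fin d) → ℝ)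
    (g : EuclideanSpace ℝ (Fin d) → EuclideanSpace ℝ (Fin d)) : Prop where
  memLp : MemLp v 2 (volume.restrict Ω)
  memLp_grad : MemLp g 2 (volume.restrict Ω)
  exists_approx : ∃ ψ : ℕ → EuclideanSpace ℝ (Fin d) → ℝ, (∀ n, IsTestFunction Ω (ψ n)) ∧
    Tendsto (fun n => eLpNorm (fun x => ψ n x - v x) 2 (volume.restrict Ω)) atTop (𝓝 0) ∧
    Tendsto (fun n => eLpNorm (fun x => gradient (ψ n) x - g x) 2
      (volume.restrict Ω)) atTop (𝓝 0)

/-- A pair carries an explicit gradient in place of the chosen `weakGradient`, which suits products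
and `L²` limits. The way back is `IsH10Pair.memH10`. -/
theorem MemH10.isH10Pair {u : EuclideanSpace ℝ (Fin d) → ℝ} (hu : MemH10 Ω u) :
    IsH10Pair Ω u (weakGradient Ω u) :=
  ⟨hu.memH1.memLp, hu.memH1.memLp_grad, hu.exists_approx⟩

namespace IsH10Pair

variable {v : EuclideanSpace ℝ (Fin d) → ℝ}
  {g : EuclideanSpace ℝ (Fin d) → EuclideanSpace ℝ (Fin d)}

theorem congr {v' : EuclideanSpace ℝ (Fin d) → ℝ}
    {g' : EuclideanSpace ℝ (Fin d) → EuclideanSpace ℝ (Fin d)} (h : IsH10Pair Ω v g)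
    (hv : v =ᵐ[volume.restrict Ω] v') (hg : g =ᵐ[volume.restrict Ω] g') : IsH10Pair Ω v' g' := by
  refine ⟨h.memLp.ae_eq hv, h.memLp_grad.ae_eq hg, ?_⟩
  obtain ⟨ψ, h0, h1, h2⟩ := h.exists_approx
  refine ⟨ψ, h0, h1.congr fun n => eLpNorm_congr_ae ?_, h2.congr fun n => eLpNorm_congr_ae ?_⟩
  · filter_upwards [hv] with x hx
    rw [hx]
  · filter_upwards [hg] with x hx
    rw [hx]

/-- Integration by parts for functions in `H^1_0(Ω)`. -/
theorem integral_by_parts (h : IsH10Pair Ω v g) (hΩ : IsBoundedDomain Ω)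
    {ζ : EuclideanSpace ℝ (Fin d) → ℝ} (hζ : ContDiff ℝ ∞ ζ) (e : EuclideanSpace ℝ (Fin d)) :
    ∫ x in Ω, ζ x * inner ℝ (g x) e = - ∫ x in Ω, v x * inner ℝ (gradient ζ x) e := by
  obtain ⟨ψ, h0, h1, h2⟩ := h.exists_approx
  have m1 : MemLp (fun x => ζ x • e) 2 (volume.restrict Ω) :=
    memLp_of_continuous hΩ (hζ.continuous.smul continuous_const) 2
  have m2 : MemLp (fun x => inner ℝ (gradient ζ x) e) 2 (volume.restrict Ω) :=
    memLp_of_continuous hΩ ((continuous_gradient hζ).inner continuous_const) 2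
  have t1 := tendsto_integral_inner (fun n => (h0 n).memLp_gradient 2) h.memLp_grad
    (fun _ => m1) m1 h2 (by simp)
  have t2 := tendsto_integral_inner (fun n => (h0 n).memLp 2) h.memLp
    (fun _ => m2) m2 h1 (by simp)
  have t3 := tendsto_nhds_unique t1 (t2.neg.congr fun n => ?_)
  · simpa only [inner_smul_right, real_inner_eq_re_inner, conj_trivial, RCLike.inner_apply,
      mul_comm] using t3
  · rw [(h0 n).integral_by_parts hζ e]
    simp only [RCLike.inner_apply, conj_trivial, mul_comm]

/-- Integration by parts passes to the limit from test functions, so being a limit of pairs `(ψ,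
∇ψ)` already makes `g` a weak gradient. -/
theorem hasWeakGradient (h : IsH10Pair Ω v g) (hΩ : IsBoundedDomain Ω) :
    HasWeakGradient Ω v g := by
  have := hΩ.isFiniteMeasure
  have i1 : IntegrableOn v Ω := h.memLp.integrable (by norm_num)
  have i2 : IntegrableOn g Ω := h.memLp_grad.integrable (by norm_num)
  refine ⟨i1.locallyIntegrableOn, i2.locallyIntegrableOn, fun ψ hψ => ?_⟩
  refine ext_inner_right ℝ fun e => ?_
  obtain ⟨C, hC⟩ := ae_bound_on hΩ hψ.contDiff.continuous
  obtain ⟨C', hC'⟩ := ae_bound_on hΩ (continuous_gradient hψ.contDiff)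
  have j1 : Integrable (fun x => v x • gradient ψ x) (volume.restrict Ω) :=
    i1.smul_bdd C' (continuous_gradient hψ.contDiff).aestronglyMeasurable hC'
  have j2 : Integrable (fun x => ψ x • g x) (volume.restrict Ω) :=
    i2.bdd_smul C hψ.contDiff.continuous.aestronglyMeasurable hC
  rw [inner_neg_left, real_inner_comm, ← integral_inner j1, real_inner_comm, ← integral_inner j2]
  have := h.integral_by_parts hΩ hψ.contDiff e
  simp only [inner_smul_right, real_inner_comm e] at this ⊢
  linarith

theorem weakGradient_ae_eq (h : IsH10Pair Ω v g) (hΩ : IsBoundedDomain Ω) :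
    weakGradient Ω v =ᵐ[volume.restrict Ω] g := by
  have hex : ∃ g, HasWeakGradient Ω v g := ⟨g, h.hasWeakGradient hΩ⟩
  refine HasWeakGradient.ae_eq hΩ.isOpen ?_ (h.hasWeakGradient hΩ)
  rw [weakGradient, dif_pos hex]
  exact hex.choose_spec

theorem memH10 (h : IsH10Pair Ω v g) (hΩ : IsBoundedDomain Ω) : MemH10 Ω v := by
  have hex : ∃ g, HasWeakGradient Ω v g := ⟨g, h.hasWeakGradient hΩ⟩
  have h2 := h.congr (ae_eq_refl v) (h.weakGradient_ae_eq hΩ).symm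
  exact ⟨⟨h2.memLp, h2.hasWeakGradient hΩ, h2.memLp_grad⟩, h2.exists_approx⟩

/-- Multiplication by a smooth function preserves `H^1_0(Ω)`. -/
theorem smooth_mul (h : IsH10Pair Ω v g) (hΩ : IsBoundedDomain Ω)
    {ζ : EuclideanSpace ℝ (Fin d) → ℝ} (hζ : ContDiff ℝ ∞ ζ) :
    IsH10Pair Ω (fun x => ζ x * v x) (fun x => ζ x • g x + v x • gradient ζ x) := by
  obtain ⟨C, hC⟩ := ae_bound_on hΩ hζ.continuous
  obtain ⟨C', hC'⟩ := ae_bound_on hΩ (continuous_gradient hζ)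
  obtain ⟨ψ, h0, h1, h2⟩ := h.exists_approx
  have hm : ∀ {w : EuclideanSpace ℝ (Fin d) → ℝ}, MemLp w 2 (volume.restrict Ω) →
      MemLp (fun x => w x • gradient ζ x) 2 (volume.restrict Ω) := fun hw =>
    hw.of_le_mul (c := C') (hw.1.smul (continuous_gradient hζ).aestronglyMeasurable)
      (hC'.mono fun x hx => by rw [norm_smul, mul_comm]; gcongr)
  have hm' : ∀ {w : EuclideanSpace ℝ (Fin d) → EuclideanSpace ℝ (Fin d)},
      MemLp w 2 (volume.restrict Ω) → MemLp (fun x => ζ x • w x) 2 (volume.restrict Ω) := fun hw =>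
    MemLp.smul_of_bound hw hζ.continuous.aestronglyMeasurable hC
  refine ⟨MemLp.smul_of_bound h.memLp hζ.continuous.aestronglyMeasurable hC,
    (hm' h.memLp_grad).add (hm h.memLp), fun n x => ζ x * ψ n x,
    fun n => (h0 n).smooth_mul hζ, tendsto_eLpNorm_smul_sub hC h1, ?_⟩
  simp only [gradient_mul hζ (h0 _).contDiff]
  refine tendsto_eLpNorm_add_sub (fun n => hm' ((h0 n).memLp_gradient 2)) (hm' h.memLp_grad)
    (fun n => hm ((h0 n).memLp 2)) (hm h.memLp) (tendsto_eLpNorm_smul_sub hC h2) ?_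
  have h3 : Tendsto (fun n => ENNReal.ofReal C' *
      eLpNorm (fun x => ψ n x - v x) 2 (volume.restrict Ω)) atTop (𝓝 0) := by
    simpa using ENNReal.Tendsto.const_mul h1 (Or.inr ENNReal.ofReal_ne_top)
  refine tendsto_of_tendsto_of_tendsto_of_le_of_le tendsto_const_nhds h3 (fun _ => zero_le)
    fun n => ?_
  refine eLpNorm_le_mul_eLpNorm_of_ae_le_mul (hC'.mono fun x hx => ?_) 2
  rw [← sub_smul, norm_smul, mul_comm]
  gcongr

end IsH10Pair

/-! ### Fourier estimates in `H^1_0(Ω)`. -/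

namespace IsH10Pair

variable {v : EuclideanSpace ℝ (Fin d) → ℝ}
  {g : EuclideanSpace ℝ (Fin d) → EuclideanSpace ℝ (Fin d)}

/-- Integration by parts against cosine and sine swaps the two integrals with a factor `±2π⟨ξ, e⟩`.
Membership in `H^1_0(Ω)` removes the boundary term. -/
theorem fourierSq_inner_grad (h : IsH10Pair Ω v g) (hΩ : IsBoundedDomain Ω)
    (e ξ : EuclideanSpace ℝ (Fin d)) :
    fourierSq Ω (fun x => inner ℝ (g x) e) ξ
      = (2 * Real.pi) ^ 2 * (inner ℝ ξ e ^ 2 * fourierSq Ω v ξ) := by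
  have h1 := h.integral_by_parts hΩ (contDiff_cos ξ) e
  have h2 := h.integral_by_parts hΩ (contDiff_sin ξ) e
  simp only [gradient_cos, inner_smul_left, conj_trivial] at h1
  simp only [gradient_sin, inner_smul_left, conj_trivial] at h2
  have e1 : ∫ x in Ω, v x * (-(2 * Real.pi * Real.sin (2 * Real.pi * inner ℝ x ξ)) * inner ℝ ξ e)
      = -(2 * Real.pi * inner ℝ ξ e) * ∫ x in Ω, v x * Real.sin (2 * Real.pi * inner ℝ x ξ) := by
    rw [← integral_const_mul]
    exact integral_congr_ae (ae_of_all _ fun x => by ring)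
  have e2 : ∫ x in Ω, v x * (2 * Real.pi * Real.cos (2 * Real.pi * inner ℝ x ξ) * inner ℝ ξ e)
      = (2 * Real.pi * inner ℝ ξ e) * ∫ x in Ω, v x * Real.cos (2 * Real.pi * inner ℝ x ξ) := by
    rw [← integral_const_mul]
    exact integral_congr_ae (ae_of_all _ fun x => by ring)
  rw [e1] at h1
  rw [e2] at h2
  simp only [fourierSq, mul_comm (inner ℝ (g _) e)]
  rw [h1, h2]
  ring

/-- Plancherel's theorem for the gradient of a function in `H^1_0(Ω)`. -/
theorem integrable_and_integral_norm_sq_mul_fourierSq (h : IsH10Pair Ω v g)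
    (hΩ : IsBoundedDomain Ω) :
    Integrable (fun ξ => (2 * Real.pi) ^ 2 * (‖ξ‖ ^ 2 * fourierSq Ω v ξ)) ∧
      ∫ ξ, (2 * Real.pi) ^ 2 * (‖ξ‖ ^ 2 * fourierSq Ω v ξ) = ∫ x in Ω, ‖g x‖ ^ 2 := by
  let b := EuclideanSpace.basisFun (Fin d) ℝ
  have hm : ∀ i, MemLp (fun x => inner ℝ (g x) (b i)) 2 (volume.restrict Ω) := fun i =>
    h.memLp_grad.inner_const (b i)
  have hP := fun i => integrable_and_integral_fourierSq hΩ.isOpen.measurableSet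
    hΩ.isBounded.measure_lt_top.ne (hm i)
  have hsum : ∀ y : EuclideanSpace ℝ (Fin d), ∑ i, inner ℝ y (b i) ^ 2 = ‖y‖ ^ 2 := fun y => by
    rw [← b.sum_sq_norm_inner_left y]
    simp
  have hF : (fun ξ => (2 * Real.pi) ^ 2 * (‖ξ‖ ^ 2 * fourierSq Ω v ξ))
      = fun ξ => ∑ i, fourierSq Ω (fun x => inner ℝ (g x) (b i)) ξ := by
    funext ξ
    simp only [h.fourierSq_inner_grad hΩ]
    rw [← Finset.mul_sum, ← Finset.sum_mul, hsum]
  rw [hF]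
  refine ⟨integrable_finsetSum _ fun i _ => (hP i).1, ?_⟩
  rw [integral_finsetSum _ fun i _ => (hP i).1]
  simp only [(hP _).2]
  rw [← integral_finsetSum _ fun i _ => (hm i).integrable_sq]
  simp only [hsum]

end IsH10Pair

/-- Subtract the vanishing integral at `η`. Cosine and sine are 1-Lipschitz, the phases differ on
`Ω` by at most `2πM‖ξ - η‖`, and Cauchy-Schwarz concludes. The factor `2` counts cosine and sine. -/
theorem fourierSq_le_of_eq_zero (hΩ : IsBoundedDomain Ω) {M : ℝ} (hM : ∀ x ∈ Ω, ‖x‖ ≤ M)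
    {v : EuclideanSpace ℝ (Fin d) → ℝ} (hv : MemLp v 2 (volume.restrict Ω))
    (ξ η : EuclideanSpace ℝ (Fin d))
    (hc : ∫ x in Ω, v x * Real.cos (2 * Real.pi * inner ℝ x η) = 0)
    (hs : ∫ x in Ω, v x * Real.sin (2 * Real.pi * inner ℝ x η) = 0) :
    fourierSq Ω v ξ ≤
      2 * ((2 * Real.pi * (M * ‖ξ - η‖)) ^ 2 * volume.real Ω) * ∫ x in Ω, v x ^ 2 := by
  have := hΩ.isFiniteMeasure
  have key : ∀ f : ℝ → ℝ, ContDiff ℝ ∞ f → (∀ a b, |f a - f b| ≤ |a - b|) →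
      ∫ x in Ω, v x * f (2 * Real.pi * inner ℝ x η) = 0 →
      (∫ x in Ω, v x * f (2 * Real.pi * inner ℝ x ξ)) ^ 2 ≤
        ((2 * Real.pi * (M * ‖ξ - η‖)) ^ 2 * volume.real Ω) * ∫ x in Ω, v x ^ 2 := by
    intro f hf hL h0
    have hcont : ∀ ζ : EuclideanSpace ℝ (Fin d),
        Continuous fun x : EuclideanSpace ℝ (Fin d) => f (2 * Real.pi * inner ℝ x ζ) := fun ζ =>
      hf.continuous.comp (by fun_prop)
    have hmem := fun ζ => memLp_of_continuous hΩ (hcont ζ) 2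
    have hdiff : ∫ x in Ω, v x * f (2 * Real.pi * inner ℝ x ξ)
        = ∫ x in Ω, v x * (f (2 * Real.pi * inner ℝ x ξ) - f (2 * Real.pi * inner ℝ x η)) := by
      simp only [mul_sub]
      refine Eq.trans ?_ (integral_sub (hv.integrable_mul (hmem ξ)) (hv.integrable_mul (hmem η))).symm
      simp only [Pi.mul_apply]
      rw [h0, sub_zero]
    rw [hdiff]
    refine (sq_integral_mul_le hv ((hmem ξ).sub (hmem η))).trans ?_
    rw [mul_comm]
    refine mul_le_mul_of_nonneg_right ?_ (integral_nonneg fun x => sq_nonneg _)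
    have hb : ∀ x ∈ Ω, (f (2 * Real.pi * inner ℝ x ξ) - f (2 * Real.pi * inner ℝ x η)) ^ 2
        ≤ (2 * Real.pi * (M * ‖ξ - η‖)) ^ 2 := by
      intro x hx
      refine sq_le_sq.2 (((hL _ _).trans ?_).trans (le_abs_self _))
      rw [← mul_sub, ← inner_sub_right, abs_mul, abs_of_pos Real.two_pi_pos]
      gcongr
      exact (abs_real_inner_le_norm _ _).trans (by gcongr; exact hM x hx)
    calc ∫ x in Ω, (f (2 * Real.pi * inner ℝ x ξ) - f (2 * Real.pi * inner ℝ x η)) ^ 2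
        ≤ ∫ x in Ω, (2 * Real.pi * (M * ‖ξ - η‖)) ^ 2 :=
          setIntegral_mono_on ((hmem ξ).sub (hmem η)).integrable_sq (integrable_const _)
            hΩ.isOpen.measurableSet hb
      _ = _ := by rw [setIntegral_const, smul_eq_mul, mul_comm]
  have h1 := key Real.cos Real.contDiff_cos Real.abs_cos_sub_cos_le hc
  have h2 := key Real.sin Real.contDiff_sin Real.abs_sin_sub_sin_le hs
  unfold fourierSq
  linarith

/-- Functions in `H^1_0(Ω)` whose Fourier integrals vanish at suitable finitely many frequencies
have a small `L²` norm. -/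
theorem exists_finite_frequencies (hΩ : IsBoundedDomain Ω) {ε : ℝ} (hε : 0 < ε) :
    ∃ F : Set (EuclideanSpace ℝ (Fin d)), F.Finite ∧
      ∀ v g, IsH10Pair Ω v g →
        (∀ η ∈ F, ∫ x in Ω, v x * Real.cos (2 * Real.pi * inner ℝ x η) = 0) →
        (∀ η ∈ F, ∫ x in Ω, v x * Real.sin (2 * Real.pi * inner ℝ x η) = 0) →
        ∫ x in Ω, v x ^ 2 ≤ ε * ((∫ x in Ω, v x ^ 2) + ∫ x in Ω, ‖g x‖ ^ 2) := by
  obtain ⟨M, hM⟩ := exists_bound_on hΩ.isBounded continuous_id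
  -- Beyond radius `R` the gradient term, multiplied by `ε`, dominates `fourierSq`.
  obtain ⟨R, hR0, hR⟩ : ∃ R : ℝ, 0 < R ∧ 1 ≤ ε * ((2 * Real.pi) ^ 2 * R ^ 2) := by
    refine ⟨(√ε * (2 * Real.pi))⁻¹, by positivity, le_of_eq ?_⟩
    have := Real.sq_sqrt hε.le
    have h2 : √ε ≠ 0 := (Real.sqrt_pos.2 hε).ne'
    field_simp
    linarith
  let B := Metric.closedBall (0 : EuclideanSpace ℝ (Fin d)) R
  -- For a `δ`-net `F` of the ball, the frequencies inside the ball contribute at most `ε ∫ v²`.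
  obtain ⟨δ, hδ0, hδ⟩ : ∃ δ : ℝ, 0 < δ ∧
      (2 * ((2 * Real.pi * (M * δ)) ^ 2 * volume.real Ω)) * volume.real B ≤ ε := by
    have hcont : Continuous fun δ : ℝ =>
        (2 * ((2 * Real.pi * (M * δ)) ^ 2 * volume.real Ω)) * volume.real B := by fun_prop
    have h0 := hcont.tendsto 0
    have h1 := (h0.mono_left (nhdsWithin_le_nhds (s := Set.Ioi 0))).eventually
      (eventually_lt_nhds (b := ε) (by simpa using hε))
    obtain ⟨δ, h2, h3⟩ := (h1.and self_mem_nhdsWithin).exists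
    exact ⟨δ, h3, h2.le⟩
  obtain ⟨F, -, hF, hcov⟩ := (isCompact_closedBall (0 : EuclideanSpace ℝ (Fin d)) R
    ).finite_cover_balls hδ0
  refine ⟨F, hF, fun v g h hc hs => ?_⟩
  have hP := integrable_and_integral_fourierSq hΩ.isOpen.measurableSet
    hΩ.isBounded.measure_lt_top.ne h.memLp
  have hG := h.integrable_and_integral_norm_sq_mul_fourierSq hΩ
  set I := ∫ x in Ω, v x ^ 2 with hI
  have hI0 : 0 ≤ I := integral_nonneg fun x => sq_nonneg _
  set K := 2 * ((2 * Real.pi * (M * δ)) ^ 2 * volume.real Ω) with hK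
  have hK0 : 0 ≤ K := by positivity
  have hpt : ∀ ξ, fourierSq Ω v ξ ≤ B.indicator (fun _ => K * I) ξ
      + ε * ((2 * Real.pi) ^ 2 * (‖ξ‖ ^ 2 * fourierSq Ω v ξ)) := by
    intro ξ
    have hnn := fourierSq_nonneg Ω v ξ
    by_cases hξ : ξ ∈ B
    · rw [Set.indicator_of_mem hξ]
      obtain ⟨η, hη, hd⟩ := Set.mem_iUnion₂.1 (hcov hξ)
      have h1 := fourierSq_le_of_eq_zero hΩ hM h.memLp ξ η (hc η hη) (hs η hη)
      have h2 : ‖ξ - η‖ ≤ δ := by rw [← dist_eq_norm]; exact (Metric.mem_ball.1 hd).le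
      have hM0 : 0 ≤ M := by
        obtain ⟨x, hx⟩ := hΩ.isConnected.nonempty
        exact (norm_nonneg _).trans (hM x hx)
      have h3 : fourierSq Ω v ξ ≤ K * I := h1.trans (by rw [hK]; gcongr)
      have h4 : 0 ≤ ε * ((2 * Real.pi) ^ 2 * (‖ξ‖ ^ 2 * fourierSq Ω v ξ)) := by positivity
      linarith
    · rw [Set.indicator_of_notMem hξ, zero_add]
      have h1 : R ≤ ‖ξ‖ := by
        simp only [B, mem_closedBall_zero_iff, not_le] at hξ
        exact hξ.le
      calc fourierSq Ω v ξ = 1 * fourierSq Ω v ξ := (one_mul _).symm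
        _ ≤ (ε * ((2 * Real.pi) ^ 2 * ‖ξ‖ ^ 2)) * fourierSq Ω v ξ := by
          gcongr
          exact hR.trans (by gcongr)
        _ = _ := by ring
  have hBm : MeasurableSet B := Metric.isClosed_closedBall.measurableSet
  have hBf : volume B ≠ ⊤ := Metric.isBounded_closedBall.measure_lt_top.ne
  have hi : Integrable (B.indicator fun _ => K * I) :=
    (integrable_indicator_iff hBm).2 (integrableOn_const hBf)
  have hint := integral_mono hP.1 (hi.add (hG.1.const_mul ε)) hpt
  simp only [Pi.add_apply] at hint
  rw [integral_add hi (hG.1.const_mul ε), integral_const_mul, hG.2, hP.2,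
    integral_indicator hBm, setIntegral_const, smul_eq_mul] at hint
  have h5 : volume.real B * (K * I) ≤ ε * I := by
    rw [← mul_assoc, mul_comm _ K]
    gcongr
  linarith

/-! ### `H^1_0(Ω)` as a Hilbert space and its compact embedding. -/

/-- The Hilbert space `L²(Ω) × L²(Ω; ℝ^d)`. -/
abbrev GraphSpace (Ω : Set (EuclideanSpace ℝ (Fin d))) : Type :=
  WithLp 2 (Lp ℝ 2 (volume.restrict Ω) × Lp (EuclideanSpace ℝ (Fin d)) 2 (volume.restrict Ω))

theorem isTestFunction_zero (Ω : Set (EuclideanSpace ℝ (Fin d))) :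
    IsTestFunction Ω (fun _ => 0) where
  contDiff := contDiff_const
  hasCompactSupport := HasCompactSupport.zero
  tsupport_subset := by simp [tsupport, Function.support]

/-- The pairs `(ψ, ∇ψ)` with `ψ ∈ C_c^∞(Ω)`. -/
def testGraph (Ω : Set (EuclideanSpace ℝ (Fin d))) : Submodule ℝ (GraphSpace Ω) where
  carrier := {a | ∃ ψ, IsTestFunction Ω ψ ∧ a.fst =ᵐ[volume.restrict Ω] ψ ∧
    a.snd =ᵐ[volume.restrict Ω] gradient ψ}
  zero_mem' := by
    refine ⟨fun _ => 0, isTestFunction_zero Ω, Lp.coeFn_zero _ _ _, ?_⟩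
    refine (Lp.coeFn_zero _ _ _).trans (ae_of_all _ fun x => ?_)
    simp [gradient]
  add_mem' := by
    rintro a b ⟨ψ, h1, h2, h3⟩ ⟨φ, h4, h5, h6⟩
    refine ⟨fun x => ψ x + φ x, h1.add h4, ?_, ?_⟩
    · filter_upwards [Lp.coeFn_add a.fst b.fst, h2, h5] with x e1 e2 e3
      rw [WithLp.add_fst, e1, Pi.add_apply, e2, e3]
    · filter_upwards [Lp.coeFn_add a.snd b.snd, h3, h6] with x e1 e2 e3
      rw [WithLp.add_snd, e1, Pi.add_apply, e2, e3]
      have d1 : DifferentiableAt ℝ ψ x := h1.contDiff.differentiable (by simp) x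
      have d2 : DifferentiableAt ℝ φ x := h4.contDiff.differentiable (by simp) x
      simp only [gradient, fderiv_fun_add d1 d2, map_add]
  smul_mem' := by
    rintro c a ⟨ψ, h1, h2, h3⟩
    refine ⟨fun x => c * ψ x, h1.smooth_mul contDiff_const, ?_, ?_⟩
    · filter_upwards [Lp.coeFn_smul c a.fst, h2] with x e1 e2
      rw [WithLp.smul_fst, e1, Pi.smul_apply, e2, smul_eq_mul]
    · filter_upwards [Lp.coeFn_smul c a.snd, h3] with x e1 e2
      rw [WithLp.smul_snd, e1, Pi.smul_apply, e2]
      have d1 : DifferentiableAt ℝ ψ x := h1.contDiff.differentiable (by simp) x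
      simp only [gradient, fderiv_const_mul d1, map_smul]

/-- `H^1_0(Ω)`, as the closed space of the pairs `(u, ∇u)`. -/
abbrev H10Space (Ω : Set (EuclideanSpace ℝ (Fin d))) : Submodule ℝ (GraphSpace Ω) :=
  (testGraph Ω).topologicalClosure

theorem isH10Pair_of_mem {a : GraphSpace Ω} (ha : a ∈ H10Space Ω) : IsH10Pair Ω a.fst a.snd := by
  obtain ⟨s, hs, hlim⟩ := mem_closure_iff_seq_limit.1 ha
  choose ψ h1 h2 h3 using hs
  refine ⟨Lp.memLp _, Lp.memLp _, ψ, h1, ?_, ?_⟩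
  · have t := ((WithLp.fstL 2 ℝ _ _).continuous.tendsto a).comp hlim
    refine ((Lp.tendsto_Lp_iff_tendsto_eLpNorm' _ _).1 t).congr fun n => eLpNorm_congr_ae ?_
    filter_upwards [h2 n] with x hx
    rw [← hx]; rfl
  · have t := ((WithLp.sndL 2 ℝ _ _).continuous.tendsto a).comp hlim
    refine ((Lp.tendsto_Lp_iff_tendsto_eLpNorm' _ _).1 t).congr fun n => eLpNorm_congr_ae ?_
    filter_upwards [h3 n] with x hx
    rw [← hx]; rfl

namespace IsH10Pair

variable {v : EuclideanSpace ℝ (Fin d) → ℝ}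
  {g : EuclideanSpace ℝ (Fin d) → EuclideanSpace ℝ (Fin d)}

/-- The element of `H^1_0(Ω)` given by a pair of functions. -/
def toH10Space (h : IsH10Pair Ω v g) : H10Space Ω :=
  ⟨WithLp.toLp 2 (h.memLp.toLp v, h.memLp_grad.toLp g), by
    obtain ⟨ψ, h0, h1, h2⟩ := h.exists_approx
    refine mem_closure_iff_seq_limit.2 ⟨fun n => WithLp.toLp 2
      (((h0 n).memLp 2).toLp (ψ n), ((h0 n).memLp_gradient 2).toLp (gradient (ψ n))), fun n =>
      ⟨ψ n, h0 n, ((h0 n).memLp 2).coeFn_toLp, ((h0 n).memLp_gradient 2).coeFn_toLp⟩, ?_⟩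
    refine ((WithLp.prod_continuous_toLp 2 _ _).tendsto _).comp (Tendsto.prodMk_nhds ?_ ?_)
    · exact (Lp.tendsto_Lp_iff_tendsto_eLpNorm'' _ (fun n => (h0 n).memLp 2) _ h.memLp).2 h1
    · exact (Lp.tendsto_Lp_iff_tendsto_eLpNorm'' _ (fun n => (h0 n).memLp_gradient 2) _
        h.memLp_grad).2 h2⟩

theorem toH10Space_snd (h : IsH10Pair Ω v g) :
    h.toH10Space.1.snd = h.memLp_grad.toLp g := rfl

end IsH10Pair

/-- The embedding of `H^1_0(Ω)` into `L²(Ω)`. -/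
def embL2 (Ω : Set (EuclideanSpace ℝ (Fin d))) :
    H10Space Ω →L[ℝ] Lp ℝ 2 (volume.restrict Ω) :=
  (WithLp.fstL 2 ℝ _ _) ∘L (H10Space Ω).subtypeL

theorem embL2_apply (w : H10Space Ω) : embL2 Ω w = w.1.fst := rfl

theorem H10Space.inner_eq (v w : H10Space Ω) :
    inner ℝ v w = inner ℝ (embL2 Ω v) (embL2 Ω w) + inner ℝ v.1.snd w.1.snd :=
  WithLp.prod_inner_apply _ _

theorem H10Space.norm_sq_eq (w : H10Space Ω) :
    ‖w‖ ^ 2 = ‖embL2 Ω w‖ ^ 2 + ‖w.1.snd‖ ^ 2 :=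
  WithLp.prod_norm_sq_eq_of_L2 _

theorem norm_Lp_sq {F : Type*} [NormedAddCommGroup F] [InnerProductSpace ℝ F]
    (f : Lp F 2 (volume.restrict Ω)) : ‖f‖ ^ 2 = ∫ x in Ω, ‖f x‖ ^ 2 := by
  rw [← norm_toLp_sq (Lp.memLp f), Lp.toLp_coeFn]

/-- The gradient is closable: a limit pair `(0, g)` has `g = 0`, by uniqueness of weak gradients. -/
theorem embL2_injective (hΩ : IsBoundedDomain Ω) (w : H10Space Ω) (hw : embL2 Ω w = 0) :
    w = 0 := by
  have h0 := isH10Pair_of_mem (0 : H10Space Ω).2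
  have h1 := isH10Pair_of_mem w.2
  rw [← embL2_apply, hw] at h1
  have h2 := HasWeakGradient.ae_eq hΩ.isOpen (h1.hasWeakGradient hΩ) (h0.hasWeakGradient hΩ)
  have h3 : w.1.snd = 0 := Lp.ext h2
  have h4 : ‖w‖ ^ 2 = 0 := by rw [H10Space.norm_sq_eq, hw, h3]; simp
  exact norm_eq_zero.1 (pow_eq_zero_iff two_ne_zero |>.1 h4)

/-- The Rellich theorem: the embedding of `H^1_0(Ω)` into `L²(Ω)` is compact. -/
theorem isCompactOperator_embL2 (hΩ : IsBoundedDomain Ω) : IsCompactOperator (embL2 Ω) := by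
  refine isCompactOperator_of_forall_small_on_orthogonal fun ε hε => ?_
  obtain ⟨F, hF, h⟩ := exists_finite_frequencies hΩ (pow_pos hε 2)
  let c := fun η => (memLp_of_continuous hΩ (contDiff_cos η).continuous 2).toLp
  let s := fun η => (memLp_of_continuous hΩ (contDiff_sin η).continuous 2).toLp
  -- Orthogonality to these sines and cosines says that the Fourier integrals vanish on `F`. The
  -- frequencies were chosen for `ε²` because the estimate is on squared norms.
  refine ⟨Submodule.span ℝ (c '' F ∪ s '' F),
    FiniteDimensional.span_of_finite ℝ ((hF.image c).union (hF.image s)), fun w hw => ?_⟩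
  rw [Submodule.mem_orthogonal] at hw
  have hp := isH10Pair_of_mem w.2
  have e : (Lp.memLp w.1.fst).toLp w.1.fst = embL2 Ω w := Lp.toLp_coeFn _ _
  have key := h _ _ hp
    (fun η hη => by
      have := hw (c η) (Submodule.subset_span (Or.inl ⟨η, hη, rfl⟩))
      rw [real_inner_comm, ← e, inner_toLp_real] at this
      exact this)
    (fun η hη => by
      have := hw (s η) (Submodule.subset_span (Or.inr ⟨η, hη, rfl⟩))
      rw [real_inner_comm, ← e, inner_toLp_real] at this
      exact this)
  have n1 : ‖embL2 Ω w‖ ^ 2 = ∫ x in Ω, w.1.fst x ^ 2 := by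
    rw [embL2_apply, norm_Lp_sq]; simp
  rw [← n1, ← norm_Lp_sq, ← H10Space.norm_sq_eq, ← mul_pow] at key
  exact (pow_le_pow_iff_left₀ (norm_nonneg _) (by positivity) two_ne_zero).1 key

/-! ### Spectral representation in the Dirichlet eigenbasis. -/

section Eigensystem

variable {ev : ℕ → ℝ} {u : ℕ → EuclideanSpace ℝ (Fin d) → ℝ}

namespace IsDirichletEigensystem

theorem isH10Pair (hu : IsDirichletEigensystem Ω ev u) (j : ℕ) :
    IsH10Pair Ω (u j) (weakGradient Ω (u j)) :=
  (hu.isEigenfunction j).isDirichletLaplacian.memH10.isH10Pair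

theorem ev_nonneg (hu : IsDirichletEigensystem Ω ev u) (j : ℕ) : 0 ≤ ev j := by
  have h1 := (hu.isEigenfunction j).isDirichletLaplacian.integral_eq (u j)
    (hu.isEigenfunction j).isDirichletLaplacian.memH10
  have h2 := hu.orthonormal j j
  rw [if_pos rfl] at h2
  simp only [mul_assoc] at h1
  rw [integral_const_mul, h2, mul_one] at h1
  rw [← h1]
  exact integral_nonneg fun x => real_inner_self_nonneg

/-- The inner product of `H10Space` is the `L²` product plus the Dirichlet form, so the eigenvalue
equation multiplies the `L²` product by `1 + λ_j`. This shift keeps the factor invertible from `λ_j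
≥ 0` alone. -/
theorem inner_embL2 (hu : IsDirichletEigensystem Ω ev u) (hΩ : IsBoundedDomain Ω) (j : ℕ)
    (w : H10Space Ω) :
    inner ℝ (embL2 Ω (hu.isH10Pair j).toH10Space) (embL2 Ω w)
      = (1 + ev j)⁻¹ * inner ℝ (hu.isH10Pair j).toH10Space w := by
  have hp := isH10Pair_of_mem w.2
  have h1 := (hu.isEigenfunction j).isDirichletLaplacian.integral_eq _ (hp.memH10 hΩ)
  have e : (Lp.memLp w.1.fst).toLp w.1.fst = embL2 Ω w := Lp.toLp_coeFn _ _
  have e' : (Lp.memLp w.1.snd).toLp w.1.snd = w.1.snd := Lp.toLp_coeFn _ _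
  have h2 : inner ℝ (embL2 Ω (hu.isH10Pair j).toH10Space) (embL2 Ω w)
      = ∫ x in Ω, u j x * w.1.fst x := by
    rw [← e]; exact inner_toLp_real (hu.isH10Pair j).memLp _
  have h3 : inner ℝ (hu.isH10Pair j).toH10Space.1.snd w.1.snd
      = ev j * ∫ x in Ω, u j x * w.1.fst x := by
    rw [← e', ← integral_const_mul]
    refine (inner_toLp (hu.isH10Pair j).memLp_grad _).trans (Eq.trans ?_ (h1.trans ?_))
    · refine integral_congr_ae ?_
      filter_upwards [hp.weakGradient_ae_eq hΩ] with x hx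
      rw [hx]
    · simp only [mul_assoc]
  rw [H10Space.inner_eq, h2, h3]
  have := hu.ev_nonneg j
  field_simp

theorem orthonormal_embL2 (hu : IsDirichletEigensystem Ω ev u) :
    Orthonormal ℝ (fun j => embL2 Ω (hu.isH10Pair j).toH10Space) := by
  rw [orthonormal_iff_ite]
  intro i j
  rw [← hu.orthonormal i j]
  exact inner_toLp_real (hu.isH10Pair i).memLp (hu.isH10Pair j).memLp

theorem inv_one_add_pos (hu : IsDirichletEigensystem Ω ev u) (j : ℕ) : 0 < (1 + ev j)⁻¹ := by
  have := hu.ev_nonneg j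
  positivity

/-- The eigenvalues are unbounded. -/
theorem exists_lt_ev (hu : IsDirichletEigensystem Ω ev u) (hΩ : IsBoundedDomain Ω) (z : ℝ) :
    ∃ j, z < ev j := by
  obtain ⟨j, hj⟩ := exists_lt_of_isCompactOperator (isCompactOperator_embL2 hΩ)
    hu.inv_one_add_pos (hu.inner_embL2 hΩ) hu.orthonormal_embL2
    (c := (1 + |z|)⁻¹) (by positivity)
  refine ⟨j, ?_⟩
  have := hu.ev_nonneg j
  rw [inv_lt_inv₀ (by positivity) (by positivity)] at hj
  linarith [le_abs_self z]

/-- Converse of `inner_embL2`: an eigenvector of `J† J` for `c` is a Dirichlet eigenfunction for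
`1/c - 1`, so exhaustiveness of the list applies. -/
theorem exists_inner_ne_zero (hu : IsDirichletEigensystem Ω ev u) (hΩ : IsBoundedDomain Ω)
    (v : H10Space Ω) (hv : v ≠ 0) (c : ℝ) (hc : 0 < c)
    (h : ∀ w, inner ℝ (embL2 Ω v) (embL2 Ω w) = c * inner ℝ v w) :
    ∃ j, inner ℝ (embL2 Ω v) (embL2 Ω (hu.isH10Pair j).toH10Space) ≠ 0 := by
  have hp := isH10Pair_of_mem v.2
  have e : (Lp.memLp v.1.fst).toLp v.1.fst = embL2 Ω v := Lp.toLp_coeFn _ _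
  have e' : (Lp.memLp v.1.snd).toLp v.1.snd = v.1.snd := Lp.toLp_coeFn _ _
  have hE : IsDirichletEigenfunction Ω (c⁻¹ - 1) v.1.fst := by
    refine ⟨⟨hp.memH10 hΩ, hp.memLp.const_mul _, fun w hw => ?_⟩, fun h0 => ?_⟩
    · have h1 := h hw.isH10Pair.toH10Space
      rw [H10Space.inner_eq] at h1
      have h2 : inner ℝ (embL2 Ω v) (embL2 Ω hw.isH10Pair.toH10Space)
          = ∫ x in Ω, v.1.fst x * w x := by
        rw [← e]; exact inner_toLp_real _ hw.isH10Pair.memLp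
      have h3 : inner ℝ v.1.snd hw.isH10Pair.toH10Space.1.snd
          = ∫ x in Ω, inner ℝ (weakGradient Ω v.1.fst x) (weakGradient Ω w x) := by
        rw [← e']
        refine (inner_toLp _ hw.isH10Pair.memLp_grad).trans (integral_congr_ae ?_)
        filter_upwards [hp.weakGradient_ae_eq hΩ] with x hx
        rw [hx]
      rw [h2, h3] at h1
      simp only [mul_assoc]
      rw [integral_const_mul]
      field_simp
      linarith
    · refine hv (embL2_injective hΩ v ?_)
      exact Lp.ext (h0.trans (Lp.coeFn_zero _ _ _).symm)
  obtain ⟨j, hj⟩ := hu.exhaustive _ _ hE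
  refine ⟨j, ?_⟩
  rw [← e]
  exact fun h0 => hj ((inner_toLp_real _ (hu.isH10Pair j).memLp).symm.trans h0)

/-- The spectral representation of the `L²(Ω)` norm and of the Dirichlet form. -/
theorem hasSum_sq (hu : IsDirichletEigensystem Ω ev u) (hΩ : IsBoundedDomain Ω)
    {v : EuclideanSpace ℝ (Fin d) → ℝ}
    {g : EuclideanSpace ℝ (Fin d) → EuclideanSpace ℝ (Fin d)} (h : IsH10Pair Ω v g) :
    HasSum (fun j => (∫ x in Ω, u j x * v x) ^ 2) (∫ x in Ω, v x ^ 2) ∧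
    HasSum (fun j => ev j * (∫ x in Ω, u j x * v x) ^ 2) (∫ x in Ω, ‖g x‖ ^ 2) := by
  have key := hasSum_of_exhaustive (isCompactOperator_embL2 hΩ) (embL2_injective hΩ)
    hu.inv_one_add_pos (hu.inner_embL2 hΩ) hu.orthonormal_embL2 (hu.exists_inner_ne_zero hΩ)
    h.toH10Space
  have h1 : ∀ j, inner ℝ (embL2 Ω (hu.isH10Pair j).toH10Space) (embL2 Ω h.toH10Space)
      = ∫ x in Ω, u j x * v x := fun j =>
    inner_toLp_real (hu.isH10Pair j).memLp h.memLp
  have h2 : ‖embL2 Ω h.toH10Space‖ ^ 2 = ∫ x in Ω, v x ^ 2 := by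
    refine (norm_toLp_sq h.memLp).trans ?_
    simp
  have h3 : ‖h.toH10Space.1.snd‖ ^ 2 = ∫ x in Ω, ‖g x‖ ^ 2 := by
    rw [h.toH10Space_snd, norm_toLp_sq]
  obtain ⟨k1, k2⟩ := key
  have h4 := H10Space.norm_sq_eq h.toH10Space
  simp only [h1, inv_inv] at k1 k2
  rw [h2] at k1
  rw [h4, h2, h3] at k2
  refine ⟨k1, ?_⟩
  -- The `H^1` norm carries the weights `1 + λ_j`. Subtracting the `L²` identity leaves the
  -- Dirichlet form.
  have k3 := k2.sub k1
  rw [add_sub_cancel_left] at k3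
  simpa only [add_mul, one_mul, add_sub_cancel_left] using k3

end IsDirichletEigensystem

end Eigensystem

section Eigensystem

variable {ev : ℕ → ℝ} {u : ℕ → EuclideanSpace ℝ (Fin d) → ℝ}
  {v : EuclideanSpace ℝ (Fin d) → ℝ} {g : EuclideanSpace ℝ (Fin d) → EuclideanSpace ℝ (Fin d)}

/-- The spectral representation of the modulated function `x ↦ exp(2πi⟨x, ξ⟩) v x`. -/
theorem IsDirichletEigensystem.hasSum_fourierSq (hu : IsDirichletEigensystem Ω ev u)
    (hΩ : IsBoundedDomain Ω) (h : IsH10Pair Ω v g) (ξ : EuclideanSpace ℝ (Fin d)) :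
    HasSum (fun j => fourierSq Ω (fun x => v x * u j x) ξ) (∫ x in Ω, v x ^ 2) ∧
    HasSum (fun j => ev j * fourierSq Ω (fun x => v x * u j x) ξ)
      ((∫ x in Ω, ‖g x‖ ^ 2) + (2 * Real.pi) ^ 2 * ‖ξ‖ ^ 2 * ∫ x in Ω, v x ^ 2) := by
  have pc := h.smooth_mul hΩ (contDiff_cos ξ)
  have ps := h.smooth_mul hΩ (contDiff_sin ξ)
  obtain ⟨c1, c2⟩ := hu.hasSum_sq hΩ pc
  obtain ⟨s1, s2⟩ := hu.hasSum_sq hΩ ps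
  -- The coefficients of the modulated `v` on `u_j` are Fourier integrals of the product `v u_j`.
  have hterm : ∀ j, (∫ x in Ω, u j x * (Real.cos (2 * Real.pi * inner ℝ x ξ) * v x)) ^ 2
      + (∫ x in Ω, u j x * (Real.sin (2 * Real.pi * inner ℝ x ξ) * v x)) ^ 2
      = fourierSq Ω (fun x => v x * u j x) ξ := fun j => by
    unfold fourierSq
    congr 2 <;> exact integral_congr_ae (ae_of_all _ fun x => by ring)
  have e1 : (∫ x in Ω, (Real.cos (2 * Real.pi * inner ℝ x ξ) * v x) ^ 2)
      + ∫ x in Ω, (Real.sin (2 * Real.pi * inner ℝ x ξ) * v x) ^ 2 = ∫ x in Ω, v x ^ 2 := by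
    rw [← integral_add pc.memLp.integrable_sq ps.memLp.integrable_sq]
    refine integral_congr_ae (ae_of_all _ fun x => ?_)
    linear_combination v x ^ 2 * Real.cos_sq_add_sin_sq (2 * Real.pi * inner ℝ x ξ)
  have e2 := (integral_add ((memLp_two_iff_integrable_sq_norm pc.memLp_grad.1).1 pc.memLp_grad)
    ((memLp_two_iff_integrable_sq_norm ps.memLp_grad.1).1 ps.memLp_grad)).symm
  -- The cross terms `∓4π v cos sin ⟨g, ξ⟩` of the two squares cancel.
  have e3 : ∀ x, ‖Real.cos (2 * Real.pi * inner ℝ x ξ) • g x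
        + v x • gradient (fun x => Real.cos (2 * Real.pi * inner ℝ x ξ)) x‖ ^ 2
      + ‖Real.sin (2 * Real.pi * inner ℝ x ξ) • g x
        + v x • gradient (fun x => Real.sin (2 * Real.pi * inner ℝ x ξ)) x‖ ^ 2
      = ‖g x‖ ^ 2 + (2 * Real.pi) ^ 2 * ‖ξ‖ ^ 2 * v x ^ 2 := fun x => by
    rw [gradient_cos, gradient_sin, smul_smul, smul_smul, norm_add_sq_real, norm_add_sq_real]
    simp only [norm_smul, mul_pow, Real.norm_eq_abs, sq_abs, inner_smul_left, inner_smul_right,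
      conj_trivial]
    linear_combination (‖g x‖ ^ 2 + (2 * Real.pi) ^ 2 * ‖ξ‖ ^ 2 * v x ^ 2) *
      Real.cos_sq_add_sin_sq (2 * Real.pi * inner ℝ x ξ)
  simp only [e3] at e2
  rw [integral_add ((memLp_two_iff_integrable_sq_norm h.memLp_grad.1).1 h.memLp_grad)
    (h.memLp.integrable_sq.const_mul _), integral_const_mul] at e2
  have r1 := c1.add s1
  have r2 := c2.add s2
  rw [e1] at r1
  rw [e2] at r2
  exact ⟨r1.congr_fun fun j => (hterm j).symm, r2.congr_fun fun j => by rw [← hterm]; ring⟩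

end Eigensystem

/-! ### The phase space integral. -/

theorem volume_real_ball_one (hd : 1 ≤ d) :
    volume.real (Metric.ball (0 : EuclideanSpace ℝ (Fin d)) 1) = unitBallVolume d := by
  have : Nonempty (Fin d) := ⟨⟨0, hd⟩⟩
  have hG : 0 < Real.Gamma ((d : ℝ) / 2 + 1) := Real.Gamma_pos_of_pos (by positivity)
  rw [Measure.real, EuclideanSpace.volume_ball]
  simp only [ENNReal.ofReal_one, one_pow, one_mul, Fintype.card_fin]
  rw [ENNReal.toReal_ofReal (by positivity), unitBallVolume, add_comm (1 : ℝ)]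
  congr 1
  rw [Real.sqrt_eq_rpow, ← Real.rpow_natCast, ← Real.rpow_mul Real.pi_pos.le]
  congr 1
  ring

theorem unitBallVolume_pos (d : ℕ) : 0 < unitBallVolume d :=
  div_pos (Real.rpow_pos_of_pos Real.pi_pos _) (Real.Gamma_pos_of_pos (by positivity))

/-- The radial integral in polar coordinates, with `n = d - 1`. The last factor is `1/(n+1) -
1/(n+3)`. -/
theorem integral_Ioi_pow_mul_max (n : ℕ) {s : ℝ} (hs : 0 ≤ s) :
    ∫ y in Set.Ioi (0 : ℝ), y ^ n * max (s ^ 2 - y ^ 2) 0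
      = s ^ (n + 3) * (2 / ((n + 1) * (n + 3))) := by
  have h1 : ∫ y in Set.Ioi (0 : ℝ), y ^ n * max (s ^ 2 - y ^ 2) 0
      = ∫ y in Set.Ioc 0 s, y ^ n * max (s ^ 2 - y ^ 2) 0 := by
    refine setIntegral_eq_of_subset_of_forall_sdiff_eq_zero measurableSet_Ioi
      (fun y hy => hy.1) fun y hy => ?_
    have hy0 : 0 < y := hy.1
    have hys : s < y := by
      by_contra h
      exact hy.2 ⟨hy0, not_lt.1 h⟩
    rw [max_eq_right (by nlinarith), mul_zero]
  have h2 : ∫ y in Set.Ioc 0 s, y ^ n * max (s ^ 2 - y ^ 2) 0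
      = ∫ y in Set.Ioc 0 s, (s ^ 2 * y ^ n - y ^ (n + 2)) := by
    refine setIntegral_congr_fun measurableSet_Ioc fun y hy => ?_
    have : y ^ 2 ≤ s ^ 2 := pow_le_pow_left₀ hy.1.le hy.2 2
    rw [max_eq_left (by linarith)]
    ring
  rw [h1, h2, ← intervalIntegral.integral_of_le hs, intervalIntegral.integral_sub
    ((by fun_prop : Continuous fun y : ℝ => s ^ 2 * y ^ n).intervalIntegrable 0 s)
    ((continuous_pow (n + 2)).intervalIntegrable 0 s),
    intervalIntegral.integral_const_mul, integral_pow, integral_pow]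
  push_cast
  field_simp
  ring

/-- The integral of the truncated paraboloid. -/
theorem integral_max_sub_norm_sq (hd : 1 ≤ d) {s : ℝ} (hs : 0 ≤ s) :
    ∫ ξ : EuclideanSpace ℝ (Fin d), max (s ^ 2 - ‖ξ‖ ^ 2) 0
      = unitBallVolume d * s ^ (d + 2) * (2 / ((d : ℝ) + 2)) := by
  obtain ⟨n, rfl⟩ : ∃ n, d = n + 1 := ⟨d - 1, by omega⟩
  rw [integral_fun_norm_addHaar volume (fun r => max (s ^ 2 - r ^ 2) 0),
    volume_real_ball_one hd, finrank_euclideanSpace_fin, Nat.add_sub_cancel]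
  simp only [smul_eq_mul, nsmul_eq_mul]
  rw [integral_Ioi_pow_mul_max n hs]
  push_cast
  have h1 : (n : ℝ) + 1 ≠ 0 := by positivity
  have h2 : (n : ℝ) + 1 + 2 = n + 3 := by ring
  rw [h2]
  field_simp

theorem integrable_max_sub_norm_sq (s : ℝ) :
    Integrable (fun ξ : EuclideanSpace ℝ (Fin d) => max (s ^ 2 - ‖ξ‖ ^ 2) 0) := by
  refine Continuous.integrable_of_hasCompactSupport (by fun_prop) ?_
  refine HasCompactSupport.of_support_subset_isCompact (isCompact_closedBall 0 |s|) fun ξ hξ => ?_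
  rw [mem_closedBall_zero_iff]
  by_contra hlt
  refine hξ (max_eq_right ?_)
  have := pow_lt_pow_left₀ (not_le.1 hlt) (abs_nonneg s) two_ne_zero
  rw [sq_abs] at this
  linarith

/-! ### The lower bound on weighted Riesz means. -/

section Riesz

variable {ev : ℕ → ℝ} {u : ℕ → EuclideanSpace ℝ (Fin d) → ℝ}
  {φ : EuclideanSpace ℝ (Fin d) → ℝ}

theorem sqNorm_real (f : EuclideanSpace ℝ (Fin d) → ℝ) : sqNorm Ω f = ∫ x in Ω, f x ^ 2 := by
  simp [sqNorm]

theorem sqNorm_nonneg {F : Type*} [NormedAddCommGroup F] (f : EuclideanSpace ℝ (Fin d) → F) :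
    0 ≤ sqNorm Ω f := integral_nonneg fun _ => by positivity

theorem sqNorm_pos (hφ : MemLp φ 2 (volume.restrict Ω))
    (hne : ¬ (φ =ᵐ[volume.restrict Ω] 0)) : 0 < sqNorm Ω φ := by
  refine lt_of_le_of_ne (sqNorm_nonneg φ) fun h0 => hne ?_
  rw [sqNorm_real] at h0
  have := (integral_eq_zero_iff_of_nonneg (fun x => sq_nonneg (φ x)) hφ.integrable_sq).1 h0.symm
  filter_upwards [this] with x hx
  exact pow_eq_zero_iff two_ne_zero |>.1 hx

theorem memLp_mul_of_top {w : EuclideanSpace ℝ (Fin d) → ℝ}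
    (hφ : MemLp φ ∞ (volume.restrict Ω)) (hw : MemLp w 2 (volume.restrict Ω)) :
    MemLp (fun x => φ x * w x) 2 (volume.restrict Ω) :=
  hw.mul hφ

theorem max_sub_ev_eq_zero (hu : IsDirichletEigensystem Ω ev u) {z : ℝ} {N : ℕ} (hN : z ≤ ev N)
    {j : ℕ} (hj : N ≤ j) : max (z - ev j) 0 = 0 :=
  max_eq_right (by linarith [hu.monotone hj])

/-- Terms from index `N` on vanish because `λ_j ≥ z` there. The Riesz mean is thus a finite sum, and
exchanging it with the integral over `ξ` is free. -/
theorem hasSum_riesz (hu : IsDirichletEigensystem Ω ev u) {z : ℝ} {N : ℕ} (hN : z ≤ ev N)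
    (a : ℕ → ℝ) : HasSum (fun j => max (z - ev j) 0 * a j)
      (∑ j ∈ Finset.range N, max (z - ev j) 0 * a j) :=
  hasSum_sum_of_ne_finset_zero fun j hj => by
    rw [max_sub_ev_eq_zero hu hN (not_lt.1 (mt Finset.mem_range.2 hj)), zero_mul]

/-- The lower bound on the Riesz means before evaluating the phase space integral. -/
theorem integral_le_riesz (hu : IsDirichletEigensystem Ω ev u) (hΩ : IsBoundedDomain Ω)
    (hφ : MemH10 Ω φ) (hφb : MemLp φ ∞ (volume.restrict Ω)) {z : ℝ} {N : ℕ} (hN : z ≤ ev N)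
    {s : ℝ} (hs : (2 * Real.pi * s) ^ 2 * sqNorm Ω φ
      = z * sqNorm Ω φ - sqNorm Ω (weakGradient Ω φ)) :
    (2 * Real.pi) ^ 2 * sqNorm Ω φ * ∫ ξ : EuclideanSpace ℝ (Fin d), max (s ^ 2 - ‖ξ‖ ^ 2) 0
      ≤ ∑ j ∈ Finset.range N, max (z - ev j) 0 * sqNorm Ω (fun x => φ x * u j x) := by
  have hP := fun j => integrable_and_integral_fourierSq hΩ.isOpen.measurableSet
    hΩ.isBounded.measure_lt_top.ne (memLp_mul_of_top hφb (hu.isH10Pair j).memLp)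
  have hpt : ∀ ξ : EuclideanSpace ℝ (Fin d),
      (2 * Real.pi) ^ 2 * sqNorm Ω φ * max (s ^ 2 - ‖ξ‖ ^ 2) 0 ≤
      ∑ j ∈ Finset.range N, max (z - ev j) 0 * fourierSq Ω (fun x => φ x * u j x) ξ := by
    intro ξ
    obtain ⟨h1, h2⟩ := hu.hasSum_fourierSq hΩ hφ.isH10Pair ξ
    rw [← sqNorm_real (Ω := Ω) φ] at h1 h2
    -- By the choice of `s` in `hs`, this sum equals `4π²‖φ‖²(s² - ‖ξ‖²)`.
    have h3 := (h1.mul_left z).sub h2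
    have h4 := hasSum_riesz hu hN fun j => fourierSq Ω (fun x => φ x * u j x) ξ
    have h5 := hasSum_le (fun j => by
      rw [← sub_mul]
      exact mul_le_mul_of_nonneg_right (le_max_left _ 0) (fourierSq_nonneg _ _ _)) h3 h4
    rw [mul_max_of_nonneg _ _ (by have := sqNorm_nonneg (Ω := Ω) φ; positivity), mul_zero]
    refine max_le (le_trans (le_of_eq ?_) h5) (Finset.sum_nonneg fun j _ =>
      mul_nonneg (le_max_right _ _) (fourierSq_nonneg _ _ _))
    have : (∫ x in Ω, ‖weakGradient Ω φ x‖ ^ 2) = sqNorm Ω (weakGradient Ω φ) := rfl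
    rw [this]
    linear_combination hs
  rw [← integral_const_mul]
  have hi : ∀ j ∈ Finset.range N, Integrable fun ξ =>
      max (z - ev j) 0 * fourierSq Ω (fun x => φ x * u j x) ξ := fun j _ => (hP j).1.const_mul _
  refine (integral_mono ((integrable_max_sub_norm_sq s).const_mul _)
    (integrable_finsetSum _ hi) hpt).trans (le_of_eq ?_)
  rw [integral_finsetSum _ hi]
  refine Finset.sum_congr rfl fun j _ => ?_
  rw [integral_const_mul, (hP j).2, sqNorm_real]

theorem rpow_phase_space (d : ℕ) {t : ℝ} (ht : 0 ≤ t) :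
    (2 * Real.pi) ^ 2 * (√t / (2 * Real.pi)) ^ (d + 2)
      = (2 * Real.pi) ^ (-(d : ℝ)) * t ^ ((d : ℝ) / 2 + 1) := by
  have h1 : √t ^ (d + 2) = t ^ ((d : ℝ) / 2 + 1) := by
    rw [Real.sqrt_eq_rpow, ← Real.rpow_natCast, ← Real.rpow_mul ht]
    congr 1
    push_cast
    ring
  rw [div_pow, h1, Real.rpow_neg Real.two_pi_pos.le, Real.rpow_natCast, pow_add]
  have := Real.two_pi_pos.ne'
  field_simp

/-- The lower bound on the weighted Riesz means, as a finite sum. -/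
theorem riesz_lower_bound (hd : 1 ≤ d) (hu : IsDirichletEigensystem Ω ev u)
    (hΩ : IsBoundedDomain Ω) (hφ : MemH10 Ω φ) (hφb : MemLp φ ∞ (volume.restrict Ω))
    (hne : ¬ (φ =ᵐ[volume.restrict Ω] 0)) {z : ℝ} {N : ℕ} (hN : z ≤ ev N) :
    2 / ((d : ℝ) + 2) * (2 * Real.pi) ^ (-(d : ℝ)) * unitBallVolume d * sqNorm Ω φ
        * max (z - sqNorm Ω (weakGradient Ω φ) / sqNorm Ω φ) 0 ^ ((d : ℝ) / 2 + 1)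
      ≤ ∑ j ∈ Finset.range N, max (z - ev j) 0 * sqNorm Ω (fun x => φ x * u j x) := by
  have hA := sqNorm_pos hφ.memH1.memLp hne
  rcases le_or_gt (z - sqNorm Ω (weakGradient Ω φ) / sqNorm Ω φ) 0 with hz | hz
  · rw [max_eq_right hz, Real.zero_rpow (by positivity), mul_zero]
    exact Finset.sum_nonneg fun j _ => mul_nonneg (le_max_right _ _) (sqNorm_nonneg _)
  · rw [max_eq_left hz.le]
    set t := z - sqNorm Ω (weakGradient Ω φ) / sqNorm Ω φ with ht
    have key := integral_le_riesz hu hΩ hφ hφb hN (s := √t / (2 * Real.pi)) (by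
      have h2 := Real.two_pi_pos.ne'
      rw [mul_div_cancel₀ _ h2, Real.sq_sqrt hz.le, ht]
      field_simp)
    rw [integral_max_sub_norm_sq hd (by positivity)] at key
    refine le_trans (le_of_eq ?_) key
    linear_combination (-(2 / ((d : ℝ) + 2) * unitBallVolume d * sqNorm Ω φ))
      * rpow_phase_space d hz.le

end Riesz

/-! ### Bounds by the sup norm, and `ρ(φ) < 1`. -/

section SupNorm

variable {φ : EuclideanSpace ℝ (Fin d) → ℝ}

theorem ae_sq_le_supNorm_sq (hφ : MemLp φ ∞ (volume.restrict Ω)) :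
    ∀ᵐ x ∂volume.restrict Ω, φ x ^ 2 ≤ supNorm Ω φ ^ 2 := by
  filter_upwards [ae_le_eLpNormEssSup (f := φ) (μ := volume.restrict Ω)] with x hx
  have h : ‖φ x‖ ≤ supNorm Ω φ := by
    rw [supNorm, eLpNorm_exponent_top, ← toReal_enorm]
    exact ENNReal.toReal_mono (by simpa using hφ.2.ne) hx
  rw [← sq_abs (φ x), ← Real.norm_eq_abs]
  exact pow_le_pow_left₀ (norm_nonneg _) h 2

theorem supNorm_sq_pos (hφ : MemLp φ ∞ (volume.restrict Ω))
    (hne : ¬ (φ =ᵐ[volume.restrict Ω] 0)) : 0 < supNorm Ω φ ^ 2 := by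
  refine lt_of_le_of_ne (sq_nonneg _) fun h0 => hne ?_
  filter_upwards [ae_sq_le_supNorm_sq hφ] with x hx
  rw [← h0] at hx
  exact pow_eq_zero_iff two_ne_zero |>.1 (le_antisymm hx (sq_nonneg _))

theorem IsBoundedDomain.volume_real_pos (hΩ : IsBoundedDomain Ω) : 0 < volume.real Ω :=
  ENNReal.toReal_pos (hΩ.isOpen.measure_pos _ hΩ.isConnected.nonempty).ne'
    hΩ.isBounded.measure_lt_top.ne

theorem sqNorm_mul_le {w : EuclideanSpace ℝ (Fin d) → ℝ} (hφ : MemLp φ ∞ (volume.restrict Ω))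
    (hw : MemLp w 2 (volume.restrict Ω)) :
    sqNorm Ω (fun x => φ x * w x) ≤ supNorm Ω φ ^ 2 * ∫ x in Ω, w x ^ 2 := by
  rw [sqNorm_real, ← integral_const_mul]
  refine integral_mono_ae (memLp_mul_of_top hφ hw).integrable_sq (hw.integrable_sq.const_mul _) ?_
  filter_upwards [ae_sq_le_supNorm_sq hφ] with x hx
  rw [mul_pow]
  gcongr

/-- Integration by parts for the square of a bounded function in `H^1_0(Ω)`. -/
theorem IsH10Pair.integral_sq_mul_inner_gradient {v : EuclideanSpace ℝ (Fin d) → ℝ}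
    {g : EuclideanSpace ℝ (Fin d) → EuclideanSpace ℝ (Fin d)} (h : IsH10Pair Ω v g)
    (hΩ : IsBoundedDomain Ω) {ζ : EuclideanSpace ℝ (Fin d) → ℝ} (hζ : ContDiff ℝ ∞ ζ)
    (e : EuclideanSpace ℝ (Fin d)) :
    ∫ x in Ω, v x * (inner ℝ (gradient ζ x) e * v x)
      = - (2 * ∫ x in Ω, v x * (ζ x * inner ℝ (g x) e)) := by
  obtain ⟨ψ, h0, h1, h2⟩ := h.exists_approx
  obtain ⟨C, hC⟩ := ae_bound_on hΩ hζ.continuous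
  have hgc : Continuous fun x => inner ℝ (gradient ζ x) e :=
    (continuous_gradient hζ).inner continuous_const
  obtain ⟨C', hC'⟩ := ae_bound_on hΩ hgc
  have m1 : MemLp (fun x => ζ x * inner ℝ (g x) e) 2 (volume.restrict Ω) :=
    MemLp.smul_of_bound (h.memLp_grad.inner_const e) hζ.continuous.aestronglyMeasurable hC
  have m2 : MemLp (fun x => inner ℝ (gradient ζ x) e * v x) 2 (volume.restrict Ω) :=
    MemLp.smul_of_bound h.memLp hgc.aestronglyMeasurable hC'
  have m3 : MemLp (fun x => (ζ x * v x) • e) 2 (volume.restrict Ω) :=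
    (MemLp.smul_of_bound h.memLp hζ.continuous.aestronglyMeasurable hC).of_le_mul (c := ‖e‖)
      ((hζ.continuous.aestronglyMeasurable.mul h.memLp.1).smul_const e)
      (ae_of_all _ fun x => by rw [norm_smul, mul_comm, smul_eq_mul])
  have t1 := tendsto_integral_inner (fun n => (h0 n).memLp 2) h.memLp (fun _ => m1) m1 h1
    (by simp)
  have t2 := tendsto_integral_inner (fun n => (h0 n).memLp 2) h.memLp (fun _ => m2) m2 h1
    (by simp)
  have t3 := tendsto_integral_inner (fun n => (h0 n).memLp_gradient 2) h.memLp_grad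
    (fun _ => m3) m3 h2 (by simp)
  -- Only one factor `v` is approximated: `ζ ψ_n` is smooth, hence admissible in
  -- `integral_by_parts`, and each limit pairs a converging sequence with a fixed `L²` function. In
  -- the limit the `g`-integral appears on both sides, which gives the factor `2`.
  have t4 := tendsto_nhds_unique t1 ((t3.add t2).neg.congr fun n => ?_)
  · simp only [inner_smul_right, RCLike.inner_apply, conj_trivial] at t4
    have e1 : ∫ x in Ω, ζ x * v x * inner ℝ (g x) e
        = ∫ x in Ω, v x * (ζ x * inner ℝ (g x) e) :=
      integral_congr_ae (ae_of_all _ fun x => by ring)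
    simp only [mul_comm _ (v _)] at t4 e1 ⊢
    simp only [mul_comm _ (v _), ← mul_assoc] at t4 e1 ⊢
    linarith
  · have b := h.integral_by_parts hΩ (hζ.mul (h0 n).contDiff) e
    have b1 : ∫ x in Ω, inner ℝ (ψ n x) (ζ x * inner ℝ (g x) e)
        = ∫ x in Ω, ζ x * ψ n x * inner ℝ (g x) e :=
      integral_congr_ae (ae_of_all _ fun x => by simp; ring)
    rw [b1, ← integral_add (integrable_inner_of_memLp ((h0 n).memLp_gradient 2) m3)
      (integrable_inner_of_memLp ((h0 n).memLp 2) m2)]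
    refine Eq.trans ?_ b.symm
    congr 1
    refine integral_congr_ae (ae_of_all _ fun x => ?_)
    simp only [gradient_mul hζ (h0 n).contDiff, inner_add_left, inner_smul_left, inner_smul_right,
      conj_trivial, RCLike.inner_apply]
    ring

theorem integral_inner_gradient_eq_zero {ζ : EuclideanSpace ℝ (Fin d) → ℝ}
    (hζ : IsTestFunction Ω ζ) (e : EuclideanSpace ℝ (Fin d)) :
    ∫ x in Ω, inner ℝ (gradient ζ x) e = 0 := by
  have := hζ.integral_by_parts (ζ := fun _ => (1 : ℝ)) contDiff_const e
  have hg : ∀ x, gradient (fun _ : EuclideanSpace ℝ (Fin d) => (1 : ℝ)) x = 0 := fun x => by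
    simp [gradient]
  simpa [hg] using this

/-- A function in `H^1_0(Ω)` with constant square vanishes. -/
theorem IsH10Pair.integral_sq_eq_zero_of_sq_const (hd : 1 ≤ d)
    {v : EuclideanSpace ℝ (Fin d) → ℝ}
    {g : EuclideanSpace ℝ (Fin d) → EuclideanSpace ℝ (Fin d)} (h : IsH10Pair Ω v g)
    (hΩ : IsBoundedDomain Ω) {m : ℝ} (hm : ∀ᵐ x ∂volume.restrict Ω, v x ^ 2 = m) :
    ∫ x in Ω, v x ^ 2 = 0 := by
  let e : EuclideanSpace ℝ (Fin d) := EuclideanSpace.single ⟨0, hd⟩ 1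
  have hprod : Integrable (fun x => v x * inner ℝ (g x) e) (volume.restrict Ω) :=
    h.memLp.integrable_mul (h.memLp_grad.inner_const e)
  -- `2 v ⟨g, e⟩` is the weak derivative of `v²` along `e`, and `v²` is constant.
  have hz : ∀ᵐ x ∂volume, x ∈ Ω → v x * inner ℝ (g x) e = 0 := by
    refine hΩ.isOpen.ae_eq_zero_of_integral_contDiff_smul_eq_zero
      (IntegrableOn.locallyIntegrableOn hprod) fun ζ s1 s2 s3 => ?_
    have hζ : IsTestFunction Ω ζ := ⟨s1, s2, s3⟩
    have key := h.integral_sq_mul_inner_gradient hΩ s1 e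
    have e1 : ∫ x in Ω, v x * (inner ℝ (gradient ζ x) e * v x) = 0 := by
      rw [← mul_zero m, ← integral_inner_gradient_eq_zero hζ e, ← integral_const_mul]
      refine integral_congr_ae ?_
      filter_upwards [hm] with x hx
      rw [← hx]; ring
    have e2 : ∫ x in Ω, ζ x • (v x * inner ℝ (g x) e)
        = ∫ x in Ω, v x * (ζ x * inner ℝ (g x) e) :=
      integral_congr_ae (ae_of_all _ fun x => by simp only [smul_eq_mul]; ring)
    rw [← setIntegral_eq_integral_of_forall_compl_eq_zero (s := Ω), e2]
    · linarith
    · intro x hx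
      rw [image_eq_zero_of_notMem_tsupport fun hx' => hx (s3 hx'), zero_smul]
  have hz' := (ae_restrict_iff' hΩ.isOpen.measurableSet).2 hz
  -- The weight is now the coordinate `x₁`, which does not vanish at the boundary: `∫ v² = -2 ∫ x₁ v
  -- ∂₁v = 0`. Here `H^1_0(Ω)` matters, as constants do lie in `H^1(Ω)`.
  have hlin : ContDiff ℝ ∞ fun x : EuclideanSpace ℝ (Fin d) => inner ℝ e x :=
    contDiff_const.inner ℝ contDiff_id
  have key := h.integral_sq_mul_inner_gradient hΩ hlin e
  have hgrad : ∀ x, inner ℝ (gradient (fun x => inner ℝ e x) x) e = 1 := fun x => by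
    rw [inner_gradient_left]
    refine (congrArg (fun L => L e) ((innerSL ℝ e).hasFDerivAt (x := x)).fderiv).trans ?_
    simp [e]
  have e3 : ∫ x in Ω, v x * (inner ℝ e x * inner ℝ (g x) e) = 0 := by
    refine integral_eq_zero_of_ae ?_
    filter_upwards [hz'] with x hx
    rw [mul_left_comm, hx, mul_zero]; rfl
  simp only [hgrad, e3, one_mul] at key
  simpa only [sq, mul_zero, neg_zero] using key

/-- If `ρ(φ) ≥ 1`, the nonnegative function `‖φ‖_∞² - φ²` has integral zero, so `φ²` is constant
almost everywhere and `φ` would vanish. -/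
theorem rho_lt_one (hd : 1 ≤ d) (hΩ : IsBoundedDomain Ω) (hφ : MemH10 Ω φ)
    (hφb : MemLp φ ∞ (volume.restrict Ω)) (hne : ¬ (φ =ᵐ[volume.restrict Ω] 0)) :
    rho Ω φ < 1 := by
  have := hΩ.isFiniteMeasure
  have hA := sqNorm_pos hφ.memH1.memLp hne
  have hm := supNorm_sq_pos hφb hne
  rw [rho, div_lt_one (mul_pos hΩ.volume_real_pos hm)]
  by_contra! hge
  rw [sqNorm_real] at hA hge
  have hi := hφ.memH1.memLp.integrable_sq
  have hci : Integrable (fun _ : EuclideanSpace ℝ (Fin d) => supNorm Ω φ ^ 2)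
      (volume.restrict Ω) := integrable_const _
  have hnn : 0 ≤ᵐ[volume.restrict Ω] fun x => supNorm Ω φ ^ 2 - φ x ^ 2 := by
    filter_upwards [ae_sq_le_supNorm_sq hφb] with x hx
    exact sub_nonneg.2 hx
  have h0 : ∫ x in Ω, (supNorm Ω φ ^ 2 - φ x ^ 2) = 0 := by
    refine le_antisymm ?_ (integral_nonneg_of_ae hnn)
    rw [integral_sub hci hi, setIntegral_const, smul_eq_mul]
    linarith
  have h1 := (integral_eq_zero_iff_of_nonneg_ae hnn (hci.sub hi)).1 h0
  have h2 := hφ.isH10Pair.integral_sq_eq_zero_of_sq_const hd hΩ (m := supNorm Ω φ ^ 2) (by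
    filter_upwards [h1] with x hx
    exact (sub_eq_zero.1 hx).symm)
  linarith

end SupNorm

/-! ### From Riesz means to eigenvalue averages. -/

/-- The Legendre transform of `t ↦ B t ^ p` is bounded by its value at the critical point. -/
theorem mul_le_add_of_rpow {k B q t : ℝ} (hk : 0 < k) (hB : 0 < B) (hq : 0 < q) (ht : 0 ≤ t) :
    k * t ≤ B * t ^ (q + 1) + k * (q / (q + 1)) * (k / (B * (q + 1))) ^ q⁻¹ := by
  -- `s` solves `k = B (q + 1) s^q`, the critical point equation of `k t - B t^(q+1)`. Bernoulli's
  -- inequality at `t / s` is the tangent line bound at `s`.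
  set s := (k / (B * (q + 1))) ^ q⁻¹ with hs
  have hs0 : 0 < s := by positivity
  have hsq : B * s ^ (q + 1) = k * s / (q + 1) := by
    rw [Real.rpow_add hs0, Real.rpow_one, hs, ← Real.rpow_mul (by positivity),
      inv_mul_cancel₀ hq.ne', Real.rpow_one]
    field_simp
  have hbern := one_add_mul_self_le_rpow_one_add (s := t / s - 1) (p := q + 1)
    (by have : 0 ≤ t / s := by positivity
        linarith) (by linarith)
  rw [add_sub_cancel] at hbern
  have hx : t ^ (q + 1) = (t / s) ^ (q + 1) * s ^ (q + 1) := by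
    rw [← Real.mul_rpow (by positivity) hs0.le, div_mul_cancel₀ _ hs0.ne']
  have h1 : k * s / (q + 1) * (1 + (q + 1) * (t / s - 1)) ≤ B * t ^ (q + 1) := by
    rw [← hsq, hx, mul_comm ((t / s) ^ (q + 1)), ← mul_assoc]
    gcongr
  have h2 : k * s / (q + 1) * (1 + (q + 1) * (t / s - 1))
      = k * t - k * (q / (q + 1)) * s := by
    field_simp
    ring
  linarith

/-- Evaluates the critical point of `mul_le_add_of_rpow` for `q = d/2`. The volume `V` cancels
between the last two factors and is there only to display `ρ`. -/
theorem classicalConst_mul_rpow (hd : 1 ≤ d) {k V A m : ℝ} (hk : 0 < k) (hV : 0 < V) (hA : 0 < A)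
    (hm : 0 < m) :
    (k / (2 / ((d : ℝ) + 2) * (2 * Real.pi) ^ (-(d : ℝ)) * unitBallVolume d * A / m
        * ((d : ℝ) / 2 + 1))) ^ ((d : ℝ) / 2)⁻¹
      = classicalConst d * (k / V) ^ (2 / (d : ℝ)) * (A / (V * m)) ^ (-(2 / (d : ℝ))) := by
  have hd0 : (0 : ℝ) < d := by exact_mod_cast hd
  have hω := unitBallVolume_pos d
  have hπ := Real.two_pi_pos
  have e1 : k / (2 / ((d : ℝ) + 2) * (2 * Real.pi) ^ (-(d : ℝ)) * unitBallVolume d * A / m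
        * ((d : ℝ) / 2 + 1))
      = (2 * Real.pi) ^ (d : ℝ) * (unitBallVolume d)⁻¹ * (k / V) * (A / (V * m))⁻¹ := by
    rw [Real.rpow_neg hπ.le]
    have := (Real.rpow_pos_of_pos hπ (d : ℝ)).ne'
    field_simp
  have e2 : ((2 * Real.pi) ^ (d : ℝ)) ^ (2 / (d : ℝ)) = 4 * Real.pi ^ 2 := by
    rw [← Real.rpow_mul hπ.le, mul_div_cancel₀ _ hd0.ne', Real.rpow_two]
    ring
  rw [e1, inv_div (d : ℝ) 2, Real.mul_rpow (by positivity) (by positivity),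
    Real.mul_rpow (by positivity) (by positivity), Real.mul_rpow (by positivity) (by positivity),
    e2, Real.inv_rpow hω.le, Real.inv_rpow (by positivity), classicalConst, Real.rpow_neg hω.le,
    Real.rpow_neg (by positivity)]

/-- The upper bound on eigenvalue averages. -/
theorem average_ev_le (hd : 1 ≤ d) (hΩ : IsBoundedDomain Ω) {ev : ℕ → ℝ}
    {u : ℕ → EuclideanSpace ℝ (Fin d) → ℝ} (hu : IsDirichletEigensystem Ω ev u)
    {φ : EuclideanSpace ℝ (Fin d) → ℝ} (hφ : MemH10 Ω φ)
    (hφb : MemLp φ ∞ (volume.restrict Ω)) (hne : ¬ (φ =ᵐ[volume.restrict Ω] 0))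
    {k : ℕ} (hk : 1 ≤ k) :
    1 / (k : ℝ) * ∑ j ∈ Finset.range k, ev j
      ≤ sqNorm Ω (weakGradient Ω φ) / sqNorm Ω φ
        + (d : ℝ) / ((d : ℝ) + 2) * classicalConst d
          * ((k : ℝ) / volume.real Ω) ^ (2 / (d : ℝ)) * rho Ω φ ^ (-(2 / (d : ℝ))) := by
  obtain ⟨n, rfl⟩ : ∃ n, k = n + 1 := ⟨k - 1, by omega⟩
  have hA := sqNorm_pos hφ.memH1.memLp hne
  have hm := supNorm_sq_pos hφb hne
  have hk0 : (0 : ℝ) < ((n + 1 : ℕ) : ℝ) := by positivity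
  have hd0 : (0 : ℝ) < d := by exact_mod_cast hd
  have hω := unitBallVolume_pos d
  have hπ := Real.two_pi_pos
  -- Here `z = ev n` is `λ_k` with `k = n + 1`. The term `j = n` of `∑ (z - ev j)` is zero, so
  -- summing over `range n` or over `range (n + 1)` is the same.
  have hR := riesz_lower_bound hd hu hΩ hφ hφb hne (le_refl (ev n))
  set z := ev n with hz
  set E := sqNorm Ω (weakGradient Ω φ) / sqNorm Ω φ with hE
  set t := max (z - E) 0 with ht
  have hsum : ∑ j ∈ Finset.range n, max (z - ev j) 0 * sqNorm Ω (fun x => φ x * u j x)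
      ≤ supNorm Ω φ ^ 2 * (((n + 1 : ℕ) : ℝ) * z - ∑ j ∈ Finset.range (n + 1), ev j) := by
    have e1 : ((n + 1 : ℕ) : ℝ) * z - ∑ j ∈ Finset.range (n + 1), ev j
        = ∑ j ∈ Finset.range n, (z - ev j) := by
      rw [Finset.sum_range_succ, Finset.sum_sub_distrib, Finset.sum_const, Finset.card_range,
        nsmul_eq_mul]
      push_cast
      ring
    rw [e1, Finset.mul_sum]
    refine Finset.sum_le_sum fun j hj => ?_
    have h1 : ev j ≤ z := hu.monotone (Finset.mem_range.1 hj).le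
    have h2 := sqNorm_mul_le hφb (hu.isH10Pair j).memLp
    have h3 := hu.orthonormal j j
    rw [if_pos rfl] at h3
    simp only [← sq] at h3
    rw [h3, mul_one] at h2
    rw [max_eq_left (by linarith), mul_comm]
    exact mul_le_mul_of_nonneg_right h2 (by linarith)
  have hB := hR.trans hsum
  set B := 2 / ((d : ℝ) + 2) * (2 * Real.pi) ^ (-(d : ℝ)) * unitBallVolume d * sqNorm Ω φ
    / supNorm Ω φ ^ 2 with hBdef
  have hB0 : 0 < B := by positivity
  have hB' : B * t ^ ((d : ℝ) / 2 + 1)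
      ≤ ((n + 1 : ℕ) : ℝ) * z - ∑ j ∈ Finset.range (n + 1), ev j := by
    rw [hBdef, div_mul_eq_mul_div, div_le_iff₀ hm, mul_comm _ (supNorm Ω φ ^ 2)]
    exact hB
  have hY := mul_le_add_of_rpow hk0 hB0 (half_pos hd0) (le_max_right (z - E) 0)
  rw [hBdef, classicalConst_mul_rpow hd hk0 hΩ.volume_real_pos hA hm, ← hBdef] at hY
  -- With `E` the Rayleigh quotient of `φ`: `∑ λ_j ≤ k z - B t^(d/2+1) ≤ k E + (k t - B t^(d/2+1))`,
  -- and `hY` bounds the bracket.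
  have hzE : ((n + 1 : ℕ) : ℝ) * z ≤ ((n + 1 : ℕ) : ℝ) * E + ((n + 1 : ℕ) : ℝ) * t := by
    rw [← mul_add]
    gcongr
    linarith [le_max_left (z - E) 0]
  have hdd : (d : ℝ) / 2 / ((d : ℝ) / 2 + 1) = (d : ℝ) / ((d : ℝ) + 2) := by field_simp
  rw [one_div, inv_mul_le_iff₀ hk0]
  rw [hdd] at hY
  change _ ≤ _ + _ * (_ * _ * rho Ω φ ^ _) at hY
  linarith

end DirichletRiesz

end

theorem mainTheorem2 (d : ℕ) (hd : 2 ≤ d)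
    (Ω : Set (EuclideanSpace ℝ (Fin d))) (hΩ : DirichletRiesz.IsBoundedDomain Ω)
    (ev : ℕ → ℝ) (u : ℕ → EuclideanSpace ℝ (Fin d) → ℝ)
    (hu : DirichletRiesz.IsDirichletEigensystem Ω ev u)
    (φ : EuclideanSpace ℝ (Fin d) → ℝ) (hφ : DirichletRiesz.MemH10 Ω φ)
    (hφ_bdd : MemLp φ ∞ (volume.restrict Ω))
    (hφ_ne : ¬ (φ =ᵐ[volume.restrict Ω] 0)) :
    (∀ z : ℝ, 0 < z →
      Summable (fun j => max (z - ev j) 0 * DirichletRiesz.sqNorm Ω (fun x => φ x * u j x)) ∧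
      2 / ((d : ℝ) + 2) * (2 * Real.pi) ^ (-(d : ℝ)) * DirichletRiesz.unitBallVolume d
          * DirichletRiesz.sqNorm Ω φ
          * max (z - DirichletRiesz.sqNorm Ω (DirichletRiesz.weakGradient Ω φ)
              / DirichletRiesz.sqNorm Ω φ) 0 ^ ((d : ℝ) / 2 + 1)
        ≤ ∑' j, max (z - ev j) 0 * DirichletRiesz.sqNorm Ω (fun x => φ x * u j x)) ∧
    (∀ k : ℕ, 1 ≤ k →
      1 / (k : ℝ) * ∑ j ∈ Finset.range k, ev j
        ≤ DirichletRiesz.sqNorm Ω (DirichletRiesz.weakGradient Ω φ) / DirichletRiesz.sqNorm Ω φ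
          + (d : ℝ) / ((d : ℝ) + 2) * DirichletRiesz.classicalConst d
            * ((k : ℝ) / volume.real Ω) ^ (2 / (d : ℝ))
            * DirichletRiesz.rho Ω φ ^ (-(2 / (d : ℝ)))) ∧
    DirichletRiesz.rho Ω φ < 1 := by
  have hd1 : 1 ≤ d := by omega
  refine ⟨fun z _ => ?_, fun k hk =>
    DirichletRiesz.average_ev_le hd1 hΩ hu hφ hφ_bdd hφ_ne hk,
    DirichletRiesz.rho_lt_one hd1 hΩ hφ hφ_bdd hφ_ne⟩
  obtain ⟨N, hN⟩ := hu.exists_lt_ev hΩ z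
  have hs := DirichletRiesz.hasSum_riesz hu hN.le
    fun j => DirichletRiesz.sqNorm Ω (fun x => φ x * u j x)
  refine ⟨hs.summable, ?_⟩
  rw [hs.tsum_eq]
  exact DirichletRiesz.riesz_lower_bound hd1 hu hΩ hφ hφ_bdd hφ_ne hN.le
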